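/- **Theorem (curvature d-tensor of the Cartan canonical connection).** Let $T$, $M$ be smooth manifolds of dimensions $p\ge 1$ and $n$, with local coordinates $(t^\alpha)$, $(x^i)$, and let $(t^\alpha,x^i,x^i_\alpha)$ be the induced coordinates on $E=J^1(T,M)$. Let $h=h_{\alpha\beta}(t)$ be a smooth symmetric nondegenerate metric on $T$, let $g_{ij}$ be a smooth symmetric nondegenerate d-tensor on $E$, and let $L:E\to\mathbb R$ be a smooth function with $$\tfrac12\frac{\partial^2L}{\partial x^i_\alpha\partial x^j_\beta}=h^{\alpha\beta}(t)\,g_{ij}(t,x,x_\gamma).$$ Summation over repeated indices is understood. Let $H^\gamma_{\alpha\beta}$ be the Christoffel symbols of $h$, and put $$\Gamma^l_{jk}=\tfrac{g^{li}}2\Big(\frac{\partial g_{ij}}{\partial x^k}+\frac{\partial g_{ik}}{\partial x^j}-\frac{\partial g_{jk}}{\partial x^i}\Big),$$ $$2\mathcal G^k=\tfrac{g^{ki}}2\Big\{\frac{\partial^2L}{\partial x^j\partial x^i_\alpha}x^j_\alpha-\frac{\partial L}{\partial x^i}+\frac{\partial^2L}{\partial t^\alpha\partial x^i_\alpha}+\frac{\partial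 L}{\partial x^i_\alpha}H^\gamma_{\alpha\gamma}+2g_{ij}h^{\alpha\beta}H^\gamma_{\alpha\beta}x^j_\gamma\Big\}.$$ The canonical nonlinear connection is $\Gamma=(M^{(i)}_{(\alpha)\beta},N^{(i)}_{(\alpha)j})$ with $M^{(i)}_{(\alpha)\beta}=-H^\gamma_{\alpha\beta}x^i_\gamma$ and $N^{(i)}_{(\alpha)j}=h_{\alpha\gamma}\,\partial\mathcal G^i/\partial x^j_\gamma$. Its adapted frame is $$\frac{\delta}{\delta t^\alpha}=\frac{\partial}{\partial t^\alpha}-M^{(j)}_{(\beta)\alpha}\frac{\partial}{\partial x^j_\beta},\qquad \frac{\delta}{\delta x^i}=\frac{\partial}{\partial x^i}-N^{(j)}_{(\beta)i}\frac{\partial}{\partial x^j_\beta},\qquad \frac{\partial}{\partial x^i_\alpha},$$ spanning the distributions $h_T$, $h_M$, $v$. A linear connection $\nabla$ is called $\Gamma$-linear if the three projections on these distributions are parallel; its coefficients are defined by $$\nabla_{\frac{\delta}{\delta t^\gamma}}\tfrac{\delta}{\delta t^\beta}=\bar G^\alpha_{\beta\gamma}\tfrac{\delta}{\delta t^\alpha},\quad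 \nabla_{\frac{\delta}{\delta x^j}}\tfrac{\delta}{\delta t^\beta}=\bar L^\alpha_{\beta j}\tfrac{\delta}{\delta t^\alpha},\quad \nabla_{\frac{\partial}{\partial x^j_\gamma}}\tfrac{\delta}{\delta t^\beta}=\bar C^{\alpha(\gamma)}_{\beta(j)}\tfrac{\delta}{\delta t^\alpha},$$ $$\nabla_{\frac{\delta}{\delta t^\gamma}}\tfrac{\delta}{\delta x^i}=G^k_{i\gamma}\tfrac{\delta}{\delta x^k},\quad \nabla_{\frac{\delta}{\delta x^j}}\tfrac{\delta}{\delta x^i}=L^k_{ij}\tfrac{\delta}{\delta x^k},\quad \nabla_{\frac{\partial}{\partial x^j_\gamma}}\tfrac{\delta}{\delta x^i}=C^{k(\gamma)}_{i(j)}\tfrac{\delta}{\delta x^k},$$ and similarly on $\partial/\partial x^i_\alpha$. It is $h$-normal if moreover $\bar G^\alpha_{\beta\gamma}=H^\alpha_{\beta\gamma}$, $\bar L=0$, $\bar C=0$ and $\nabla J=0$, where $J=h_{\alpha\beta}\,\frac{\partial}{\partial x^i_\alpha}\otimes dt^\beta\otimes dx^i$. On the domain of every such chart of $E$ there is exactly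 one $h$-normal $\Gamma$-linear connection $\nabla$, the *Cartan canonical connection*, with $$g_{ij|k}=0,\quad g_{ij}|^{(\gamma)}_{(k)}=0,\quad G^k_{j\gamma}=\tfrac{g^{ki}}2\frac{\delta g_{ij}}{\delta t^\gamma},\quad L^k_{ij}=L^k_{ji},\quad C^{i(\gamma)}_{j(k)}=C^{i(\gamma)}_{k(j)}.$$ Let $R(X,Y)Z=\nabla_X\nabla_YZ-\nabla_Y\nabla_XZ-\nabla_{[X,Y]}Z$ be its curvature. Then $R$ is determined by the following local components. **i) $p=1$** (the index $1$ is the only temporal index; $/1$ and $|j$ are the $T$- and $M$-horizontal covariant derivatives of $\nabla$). Every $R(X,Y)\frac{\delta}{\delta t}$ with $X,Y$ in the adapted frame vanishes, $R(\frac\delta{\delta t},\frac\delta{\delta t})=0$, and $$R(\tfrac{\delta}{\delta x^k},\tfrac{\delta}{\delta t})\tfrac{\delta}{\delta x^i}=R^l_{i1k}\tfrac{\delta}{\delta x^l},\quad R(\tfrac{\delta}{\delta x^k},\tfrac{\delta}{\delta x^j})\tfrac{\delta}{\delta x^i}=R^l_{ijk}\tfrac{\delta}{\delta x^l},$$ $$R(\tfrac{\partial}{\partial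 x^k_1},\tfrac{\delta}{\delta t})\tfrac{\delta}{\delta x^i}=P^{l\,(1)}_{i1(k)}\tfrac{\delta}{\delta x^l},\quad R(\tfrac{\partial}{\partial x^k_1},\tfrac{\delta}{\delta x^j})\tfrac{\delta}{\delta x^i}=P^{l\,(1)}_{ij(k)}\tfrac{\delta}{\delta x^l},\quad R(\tfrac{\partial}{\partial x^k_1},\tfrac{\partial}{\partial x^j_1})\tfrac{\delta}{\delta x^i}=S^{l(1)(1)}_{i(j)(k)}\tfrac{\delta}{\delta x^l};$$ the same formulas hold with $\frac\delta{\delta x^i},\frac{\delta}{\delta x^l}$ (as third argument and in the value) replaced by $\frac{\partial}{\partial x^i_1},\frac{\partial}{\partial x^l_1}$. Here $$R^l_{i1k}=\frac{\delta G^l_{i1}}{\delta x^k}-\frac{\delta L^l_{ik}}{\delta t}+G^m_{i1}L^l_{mk}-L^m_{ik}G^l_{m1}+C^{l(1)}_{i(m)}R^{(m)}_{(1)1k},$$ $$R^l_{ijk}=\frac{\delta L^l_{ij}}{\delta x^k}-\frac{\delta L^l_{ik}}{\delta x^j}+L^m_{ij}L^l_{mk}-L^m_{ik}L^l_{mj}+C^{l(1)}_{i(m)}R^{(m)}_{(1)jk},$$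 $$P^{l\,(1)}_{i1(k)}=\frac{\partial G^l_{i1}}{\partial x^k_1}-C^{l(1)}_{i(k)/1}+C^{l(1)}_{i(m)}P^{(m)\,(1)}_{(1)1(k)},\qquad P^{l\,(1)}_{ij(k)}=\frac{\partial L^l_{ij}}{\partial x^k_1}-C^{l(1)}_{i(k)|j}+C^{l(1)}_{i(m)}P^{(m)\,(1)}_{(1)j(k)},$$ $$S^{l(1)(1)}_{i(j)(k)}=\frac{\partial C^{l(1)}_{i(j)}}{\partial x^k_1}-\frac{\partial C^{l(1)}_{i(k)}}{\partial x^j_1}+C^{m(1)}_{i(j)}C^{l(1)}_{m(k)}-C^{m(1)}_{i(k)}C^{l(1)}_{m(j)},$$ with $R^{(m)}_{(1)1k}=\frac{\delta M^{(m)}_{(1)1}}{\delta x^k}-\frac{\delta N^{(m)}_{(1)k}}{\delta t}$, $R^{(m)}_{(1)jk}=\frac{\delta N^{(m)}_{(1)j}}{\delta x^k}-\frac{\delta N^{(m)}_{(1)k}}{\delta x^j}$, $P^{(m)\,(1)}_{(1)1(k)}=\frac{\partial M^{(m)}_{(1)1}}{\partial x^k_1}-G^m_{k1}+\delta^m_kH^1_{11}$,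 $P^{(m)\,(1)}_{(1)j(k)}=\frac{\partial N^{(m)}_{(1)j}}{\partial x^k_1}-L^m_{kj}$. **ii) $p\ge2$.** $$R(\tfrac{\delta}{\delta t^\gamma},\tfrac{\delta}{\delta t^\beta})\tfrac{\delta}{\delta t^\eta}=H^\alpha_{\eta\beta\gamma}\tfrac{\delta}{\delta t^\alpha},\quad R(\tfrac{\delta}{\delta t^\gamma},\tfrac{\delta}{\delta t^\beta})\tfrac{\delta}{\delta x^i}=R^l_{i\beta\gamma}\tfrac{\delta}{\delta x^l},\quad R(\tfrac{\delta}{\delta t^\gamma},\tfrac{\delta}{\delta t^\beta})\tfrac{\partial}{\partial x^i_\alpha}=\big(\delta^\alpha_\eta R^l_{i\beta\gamma}-\delta^l_iH^\alpha_{\eta\beta\gamma}\big)\tfrac{\partial}{\partial x^l_\eta},$$ $$R(\tfrac{\delta}{\delta x^k},\tfrac{\delta}{\delta t^\beta})\tfrac{\delta}{\delta x^i}=R^l_{i\beta k}\tfrac{\delta}{\delta x^l},\qquad R(\tfrac{\delta}{\delta x^k},\tfrac{\delta}{\delta t^\beta})\tfrac{\partial}{\partial x^i_\alpha}=\delta^\alpha_\eta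 R^l_{i\beta k}\tfrac{\partial}{\partial x^l_\eta},$$ $$R(\tfrac{\delta}{\delta x^k},\tfrac{\delta}{\delta x^j})\tfrac{\delta}{\delta x^i}=r^l_{ijk}\tfrac{\delta}{\delta x^l},\qquad R(\tfrac{\delta}{\delta x^k},\tfrac{\delta}{\delta x^j})\tfrac{\partial}{\partial x^i_\alpha}=\delta^\alpha_\eta r^l_{ijk}\tfrac{\partial}{\partial x^l_\eta},$$ and all remaining components of $R$ vanish: $R(\frac{\delta}{\delta x^k},\cdot)\frac{\delta}{\delta t^\eta}=0$ on horizontal arguments, and $R(X,Y)=0$ on all three distributions whenever $X$ is one of the $\frac{\partial}{\partial x^k_\gamma}$ (so all $P$- and $S$-components vanish). Here $$H^\alpha_{\eta\beta\gamma}=\frac{\partial H^\alpha_{\eta\beta}}{\partial t^\gamma}-\frac{\partial H^\alpha_{\eta\gamma}}{\partial t^\beta}+H^\mu_{\eta\beta}H^\alpha_{\mu\gamma}-H^\mu_{\eta\gamma}H^\alpha_{\mu\beta},$$ $$R^l_{i\beta\gamma}=\frac{\delta G^l_{i\beta}}{\delta t^\gamma}-\frac{\delta G^l_{i\gamma}}{\delta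 t^\beta}+G^m_{i\beta}G^l_{m\gamma}-G^m_{i\gamma}G^l_{m\beta},$$ $$R^l_{i\beta k}=\frac{\delta G^l_{i\beta}}{\delta x^k}-\frac{\delta\Gamma^l_{ik}}{\delta t^\beta}+G^m_{i\beta}\Gamma^l_{mk}-\Gamma^m_{ik}G^l_{m\beta},$$ $$r^l_{ijk}=\frac{\partial\Gamma^l_{ij}}{\partial x^k}-\frac{\partial\Gamma^l_{ik}}{\partial x^j}+\Gamma^m_{ij}\Gamma^l_{mk}-\Gamma^m_{ik}\Gamma^l_{mj}.$$ -/

import Mathlib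

open scoped ContDiff Manifold

noncomputable section

namespace MultiTime

/-! ## Local coordinates on the first jet space -/

/-- Coordinates `(t^α, x^i, x^i_α)` on `J¹(T, M)`; the third component is `v i α = x^i_α`. -/
abbrev Jet (p n : ℕ) : Type := (Fin p → ℝ) × (Fin n → ℝ) × (Fin n → Fin p → ℝ)

variable {p n : ℕ}

/-- The coordinate vector `∂/∂t^α`. -/
def eT (α : Fin p) : Jet p n := (Pi.single α 1, 0, 0)

/-- The coordinate vector `∂/∂x^i`. -/
def eX (i : Fin n) : Jet p n := (0, Pi.single i 1, 0)

/-- The coordinate vector `∂/∂x^i_α`. -/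
def eV (i : Fin n) (α : Fin p) : Jet p n := (0, 0, Pi.single i (Pi.single α 1))

/-- The derivative of the function `f` along the vector field `X`. -/
def along (X : Jet p n → Jet p n) (f : Jet p n → ℝ) : Jet p n → ℝ := fun z => fderiv ℝ f z (X z)

/-- `∂f/∂t^α`. -/
def pdT (α : Fin p) (f : Jet p n → ℝ) : Jet p n → ℝ := along (fun _ => eT α) f

/-- `∂f/∂x^i`. -/
def pdX (i : Fin n) (f : Jet p n → ℝ) : Jet p n → ℝ := along (fun _ => eX i) f

/-- `∂f/∂x^i_α`. -/
def pdV (i : Fin n) (α : Fin p) (f : Jet p n → ℝ) : Jet p n → ℝ := along (fun _ => eV i α) f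

/-- `∂f/∂t^α` for a function of `t` alone. -/
def pd (α : Fin p) (f : (Fin p → ℝ) → ℝ) : (Fin p → ℝ) → ℝ :=
  fun t => fderiv ℝ f t (Pi.single α 1)

/-- The Kronecker symbol. -/
def kron {ι : Type} [DecidableEq ι] (a b : ι) : ℝ := if a = b then 1 else 0

/-! ## The local expression of a metrical multi-time Lagrange space -/

/-- The local components, in a chart of `T` with image `U` and a chart of `M` with image `V`, of the
temporal metric `h`, of the d-tensor `g` and of the Lagrangian function `L`. -/
structure LocalData (p n : ℕ) where
  U : Set (Fin p → ℝ)
  V : Set (Fin n → ℝ)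
  h : Fin p → Fin p → (Fin p → ℝ) → ℝ
  g : Fin n → Fin n → Jet p n → ℝ
  L : Jet p n → ℝ

namespace LocalData

variable (S : LocalData p n)

/-- The domain `U × V × ℝ^{np}` of the induced chart of `J¹(T, M)`. -/
def dom : Set (Jet p n) := {z | z.1 ∈ S.U ∧ z.2.1 ∈ S.V}

/-- `h^{αβ}`. -/
def hInv (α β : Fin p) (t : Fin p → ℝ) : ℝ := (Matrix.of fun a b => S.h a b t)⁻¹ α β

/-- `g^{ij}`. -/
def gInv (i j : Fin n) (z : Jet p n) : ℝ := (Matrix.of fun a b => S.g a b z)⁻¹ i j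

/-- The Christoffel symbols `H^γ_{αβ}` of `h`. -/
def H (γ α β : Fin p) (t : Fin p → ℝ) : ℝ :=
  ∑ μ, S.hInv γ μ t / 2 * (pd β (S.h μ α) t + pd α (S.h μ β) t - pd μ (S.h α β) t)

/-- The curvature `H^α_{ηβγ}` of `h`. -/
def Hcurv (α η β γ : Fin p) (t : Fin p → ℝ) : ℝ :=
  pd γ (S.H α η β) t - pd β (S.H α η γ) t
    + ∑ μ, (S.H μ η β t * S.H α μ γ t - S.H μ η γ t * S.H α μ β t)

/-- The generalized Christoffel symbols `Γ^l_{jk}` of `g`. -/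
def Chr (l j k : Fin n) (z : Jet p n) : ℝ :=
  ∑ i, S.gInv l i z / 2 * (pdX k (S.g i j) z + pdX j (S.g i k) z - pdX i (S.g j k) z)

/-- The curvature `r^l_{ijk}` of `g`. -/
def r (l i j k : Fin n) (z : Jet p n) : ℝ :=
  pdX k (S.Chr l i j) z - pdX j (S.Chr l i k) z
    + ∑ m, (S.Chr m i j z * S.Chr l m k z - S.Chr m i k z * S.Chr l m j z)

/-- The canonical spatial `h`-spray `𝒢^k` of `L`. -/
def spray (k : Fin n) (z : Jet p n) : ℝ :=
  (1 / 2) * ∑ i, S.gInv k i z / 2 *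
    ((∑ j, ∑ α, pdX j (pdV i α S.L) z * z.2.2 j α)
      - pdX i S.L z
      + (∑ α, pdT α (pdV i α S.L) z)
      + (∑ α, ∑ γ, pdV i α S.L z * S.H γ α γ z.1)
      + 2 * ∑ j, ∑ α, ∑ β, ∑ γ, S.g i j z * S.hInv α β z.1 * S.H γ α β z.1 * z.2.2 j γ)

/-- The temporal components `M^{(i)}_{(α)β}` of the canonical nonlinear connection. -/
def M (i : Fin n) (α β : Fin p) (z : Jet p n) : ℝ := -∑ γ, S.H γ α β z.1 * z.2.2 i γ

/-- The spatial components `N^{(i)}_{(α)j} = (∂𝒢^i/∂x^j_γ) h_{αγ}` of the canonical nonlinear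
connection. -/
def N (i : Fin n) (α : Fin p) (j : Fin n) (z : Jet p n) : ℝ :=
  ∑ γ, pdV j γ (S.spray i) z * S.h α γ z.1

/-! ### The adapted frame -/

/-- `δ/δt^α`. -/
def δT (α : Fin p) : Jet p n → Jet p n := fun z => eT α - ∑ j, ∑ β, S.M j β α z • eV j β

/-- `δ/δx^i`. -/
def δX (i : Fin n) : Jet p n → Jet p n := fun z => eX i - ∑ j, ∑ β, S.N j β i z • eV j β

/-- `∂/∂x^i_α`, as a vector field. -/
def δV (_S : LocalData p n) (i : Fin n) (α : Fin p) : Jet p n → Jet p n := fun _ => eV i α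

/-- `dt^α(w)` for a tangent vector `w`. -/
def dt (_S : LocalData p n) (α : Fin p) (w : Jet p n) : ℝ := w.1 α

/-- `dx^i(w)` for a tangent vector `w`. -/
def dx (_S : LocalData p n) (i : Fin n) (w : Jet p n) : ℝ := w.2.1 i

/-- `δx^i_α(w)` for a tangent vector `w` at `z`. -/
def dv (i : Fin n) (α : Fin p) (z w : Jet p n) : ℝ :=
  w.2.2 i α + ∑ β, S.M i α β z * w.1 β + ∑ j, S.N i α j z * w.2.1 j

/-- The `T`-horizontal projection. -/
def projT (z w : Jet p n) : Jet p n := ∑ α, S.dt α w • S.δT α z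

/-- The `M`-horizontal projection. -/
def projX (z w : Jet p n) : Jet p n := ∑ i, S.dx i w • S.δX i z

/-- The vertical projection. -/
def projV (z w : Jet p n) : Jet p n := ∑ i, ∑ α, S.dv i α z w • S.δV i α z

/-- The normalization d-tensor `J = h_{αβ} δ^i_j ∂/∂x^i_α ⊗ dt^β ⊗ dx^j`, applied to `(u, w)`. -/
def normJ (z u w : Jet p n) : Jet p n :=
  ∑ i, ∑ α, ((∑ β, S.h α β z.1 * S.dt β u) * S.dx i w) • S.δV i α z

end LocalData

/-! ## Linear connections on the domain of a chart -/

/-- A linear connection `∇` on an open subset of the coordinate space, given by its Christoffel map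
`A` in the coordinate frame: `(∇_X Y)(z) = DY(z)(X z) + A z (X z) (Y z)`. -/
abbrev LinConn (p n : ℕ) : Type := Jet p n → Jet p n →L[ℝ] Jet p n →L[ℝ] Jet p n

/-- `∇_X Y`. -/
def cov (A : LinConn p n) (X Y : Jet p n → Jet p n) : Jet p n → Jet p n :=
  fun z => fderiv ℝ Y z (X z) + A z (X z) (Y z)

/-- The curvature `R(X, Y)Z = ∇_X ∇_Y Z - ∇_Y ∇_X Z - ∇_{[X, Y]} Z`. -/
def curv (A : LinConn p n) (X Y Z : Jet p n → Jet p n) : Jet p n → Jet p n :=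
  fun z => cov A X (cov A Y Z) z - cov A Y (cov A X Z) z
    - cov A (VectorField.lieBracket ℝ X Y) Z z

namespace LocalData

variable (S : LocalData p n) (A : LinConn p n)

/-- The vector field `X` is smooth on the domain of the chart. -/
def SmoothField (X : Jet p n → Jet p n) : Prop := ContDiffOn ℝ ∞ X S.dom

/-! ### Local coefficients in the adapted frame -/

/-- `Ḡ^α_{βγ}`, the coefficient of `∇_{δ/δt^γ} δ/δt^β` on `δ/δt^α`. -/
def cGbar (α β γ : Fin p) (z : Jet p n) : ℝ := S.dt α (cov A (S.δT γ) (S.δT β) z)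

/-- `G^k_{iγ}`. -/
def cG (k i : Fin n) (γ : Fin p) (z : Jet p n) : ℝ := S.dx k (cov A (S.δT γ) (S.δX i) z)

/-- `G^{(k)(β)}_{(α)(i)γ}`. -/
def cGv (k : Fin n) (β α : Fin p) (i : Fin n) (γ : Fin p) (z : Jet p n) : ℝ :=
  S.dv k α z (cov A (S.δT γ) (S.δV i β) z)

/-- `L̄^α_{βj}`. -/
def cLbar (α β : Fin p) (j : Fin n) (z : Jet p n) : ℝ := S.dt α (cov A (S.δX j) (S.δT β) z)

/-- `L^k_{ij}`. -/
def cL (k i j : Fin n) (z : Jet p n) : ℝ := S.dx k (cov A (S.δX j) (S.δX i) z)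

/-- `L^{(k)(β)}_{(α)(i)j}`. -/
def cLv (k : Fin n) (β α : Fin p) (i j : Fin n) (z : Jet p n) : ℝ :=
  S.dv k α z (cov A (S.δX j) (S.δV i β) z)

/-- `C̄^{α(γ)}_{β(j)}`. -/
def cCbar (α : Fin p) (γ β : Fin p) (j : Fin n) (z : Jet p n) : ℝ :=
  S.dt α (cov A (S.δV j γ) (S.δT β) z)

/-- `C^{k(γ)}_{i(j)}`. -/
def cC (k : Fin n) (γ : Fin p) (i j : Fin n) (z : Jet p n) : ℝ :=
  S.dx k (cov A (S.δV j γ) (S.δX i) z)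

/-! ### The Cartan canonical connection -/

/-- `∇` is a smooth `Γ`-linear connection for the canonical nonlinear connection `Γ`: the three
projections are parallel. -/
structure IsGammaLinear : Prop where
  smooth : ContDiffOn ℝ ∞ A S.dom
  parallelT : ∀ X Y, S.SmoothField X → S.SmoothField Y → ∀ z ∈ S.dom,
    cov A X (fun w => S.projT w (Y w)) z = S.projT z (cov A X Y z)
  parallelX : ∀ X Y, S.SmoothField X → S.SmoothField Y → ∀ z ∈ S.dom,
    cov A X (fun w => S.projX w (Y w)) z = S.projX z (cov A X Y z)
  parallelV : ∀ X Y, S.SmoothField X → S.SmoothField Y → ∀ z ∈ S.dom,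
    cov A X (fun w => S.projV w (Y w)) z = S.projV z (cov A X Y z)

/-- `∇` is an `h`-normal `Γ`-linear connection. -/
structure IsHNormal : Prop extends IsGammaLinear S A where
  Gbar_eq : ∀ α β γ, ∀ z ∈ S.dom, S.cGbar A α β γ z = S.H α β γ z.1
  Lbar_eq : ∀ α β j, ∀ z ∈ S.dom, S.cLbar A α β j z = 0
  Cbar_eq : ∀ α γ β j, ∀ z ∈ S.dom, S.cCbar A α γ β j z = 0
  parallelJ : ∀ W X Y, S.SmoothField W → S.SmoothField X → S.SmoothField Y → ∀ z ∈ S.dom,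
    cov A W (fun w => S.normJ w (X w) (Y w)) z
      = S.normJ z (cov A W X z) (Y z) + S.normJ z (X z) (cov A W Y z)

/-- `∇` is the Cartan canonical connection: it is `h`-normal, `g_{ij|k} = 0`,
`g_{ij}|^{(γ)}_{(k)} = 0`, `G^k_{jγ} = (g^{ki}/2) δg_{ij}/δt^γ`, and `L^k_{ij}`, `C^{i(γ)}_{j(k)}`
are symmetric in the two lower indices. -/
structure IsCartan : Prop extends IsHNormal S A where
  metricX : ∀ i j k, ∀ z ∈ S.dom,
    along (S.δX k) (S.g i j) z
      - ∑ m, (S.cL A m i k z * S.g m j z + S.cL A m j k z * S.g i m z) = 0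
  metricV : ∀ i j k γ, ∀ z ∈ S.dom,
    along (S.δV k γ) (S.g i j) z
      - ∑ m, (S.cC A m γ i k z * S.g m j z + S.cC A m γ j k z * S.g i m z) = 0
  G_eq : ∀ k j γ, ∀ z ∈ S.dom,
    S.cG A k j γ z = ∑ i, S.gInv k i z / 2 * along (S.δT γ) (S.g i j) z
  L_symm : ∀ k i j, ∀ z ∈ S.dom, S.cL A k i j z = S.cL A k j i z
  C_symm : ∀ i γ j k, ∀ z ∈ S.dom, S.cC A i γ j k z = S.cC A i γ k j z

/-! ### Torsion components and covariant derivatives entering the curvature formulas -/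

/-- `R^{(m)}_{(μ)αj} = δM^{(m)}_{(μ)α}/δx^j - δN^{(m)}_{(μ)j}/δt^α`. -/
def torTX (m : Fin n) (μ α : Fin p) (j : Fin n) (z : Jet p n) : ℝ :=
  along (S.δX j) (S.M m μ α) z - along (S.δT α) (S.N m μ j) z

/-- `R^{(m)}_{(μ)ij} = δN^{(m)}_{(μ)i}/δx^j - δN^{(m)}_{(μ)j}/δx^i`. -/
def torXX (m : Fin n) (μ : Fin p) (i j : Fin n) (z : Jet p n) : ℝ :=
  along (S.δX j) (S.N m μ i) z - along (S.δX i) (S.N m μ j) z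

/-- `P^{(m)(β)}_{(μ)α(j)} = ∂M^{(m)}_{(μ)α}/∂x^j_β - δ^β_μ G^m_{jα} + δ^m_j H^β_{μα}`. -/
def torPT (m : Fin n) (β μ α : Fin p) (j : Fin n) (z : Jet p n) : ℝ :=
  pdV j β (S.M m μ α) z - kron β μ * S.cG A m j α z + kron m j * S.H β μ α z.1

/-- `P^{(m)(β)}_{(μ)i(j)} = ∂N^{(m)}_{(μ)i}/∂x^j_β - δ^β_μ L^m_{ji}`. -/
def torPX (m : Fin n) (β μ : Fin p) (i j : Fin n) (z : Jet p n) : ℝ :=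
  pdV j β (S.N m μ i) z - kron β μ * S.cL A m j i z

/-- The `T`-horizontal covariant derivative `C^{l(γ)}_{i(k)/β}`. -/
def covTC (l : Fin n) (γ : Fin p) (i k : Fin n) (β : Fin p) (z : Jet p n) : ℝ :=
  along (S.δT β) (S.cC A l γ i k) z
    + ∑ m, S.cC A m γ i k z * S.cG A l m β z
    - ∑ m, S.cC A l γ m k z * S.cG A m i β z
    - ∑ m, ∑ μ, S.cC A l μ i m z * S.cGv A m γ μ k β z

/-- The `M`-horizontal covariant derivative `C^{l(γ)}_{i(k)|j}`. -/
def covXC (l : Fin n) (γ : Fin p) (i k j : Fin n) (z : Jet p n) : ℝ :=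
  along (S.δX j) (S.cC A l γ i k) z
    + ∑ m, S.cC A m γ i k z * S.cL A l m j z
    - ∑ m, S.cC A l γ m k z * S.cL A m i j z
    - ∑ m, ∑ μ, S.cC A l μ i m z * S.cLv A m γ μ k j z

/-! ### The curvature components for `p = 1`

The unique value of the temporal index, written `1` in the classical notation, is `τ`. -/

/-- `R^l_{i1k}`. -/
def oneRTX (τ : Fin p) (l i k : Fin n) (z : Jet p n) : ℝ :=
  along (S.δX k) (S.cG A l i τ) z - along (S.δT τ) (S.cL A l i k) z
    + ∑ m, S.cG A m i τ z * S.cL A l m k z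
    - ∑ m, S.cL A m i k z * S.cG A l m τ z
    + ∑ m, S.cC A l τ i m z * S.torTX m τ τ k z

/-- `R^l_{ijk}`. -/
def oneRXX (τ : Fin p) (l i j k : Fin n) (z : Jet p n) : ℝ :=
  along (S.δX k) (S.cL A l i j) z - along (S.δX j) (S.cL A l i k) z
    + ∑ m, S.cL A m i j z * S.cL A l m k z
    - ∑ m, S.cL A m i k z * S.cL A l m j z
    + ∑ m, S.cC A l τ i m z * S.torXX m τ j k z

/-- `P^{l(1)}_{i1(k)}`. -/
def onePT (τ : Fin p) (l i k : Fin n) (z : Jet p n) : ℝ :=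
  pdV k τ (S.cG A l i τ) z - S.covTC A l τ i k τ z
    + ∑ m, S.cC A l τ i m z * S.torPT A m τ τ τ k z

/-- `P^{l(1)}_{ij(k)}`. -/
def onePX (τ : Fin p) (l i j k : Fin n) (z : Jet p n) : ℝ :=
  pdV k τ (S.cL A l i j) z - S.covXC A l τ i k j z
    + ∑ m, S.cC A l τ i m z * S.torPX A m τ τ j k z

/-- `S^{l(1)(1)}_{i(j)(k)}`. -/
def oneS (τ : Fin p) (l i j k : Fin n) (z : Jet p n) : ℝ :=
  pdV k τ (S.cC A l τ i j) z - pdV j τ (S.cC A l τ i k) z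
    + ∑ m, S.cC A m τ i j z * S.cC A l τ m k z
    - ∑ m, S.cC A m τ i k z * S.cC A l τ m j z

/-! ### The curvature components for `p ≥ 2` -/

/-- `R^l_{iβγ}`. -/
def multiRTT (l i : Fin n) (β γ : Fin p) (z : Jet p n) : ℝ :=
  along (S.δT γ) (S.cG A l i β) z - along (S.δT β) (S.cG A l i γ) z
    + ∑ m, S.cG A m i β z * S.cG A l m γ z
    - ∑ m, S.cG A m i γ z * S.cG A l m β z

/-- `R^l_{iβk}`. -/
def multiRTX (l i : Fin n) (β : Fin p) (k : Fin n) (z : Jet p n) : ℝ :=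
  along (S.δX k) (S.cG A l i β) z - along (S.δT β) (S.Chr l i k) z
    + ∑ m, S.cG A m i β z * S.Chr l m k z
    - ∑ m, S.Chr m i k z * S.cG A l m β z

/-- The table of the curvature d-tensor at the point `z` for `p = 1`. The rows are
`h_T h_T`, `h_M h_T`, `h_M h_M`, `v h_T`, `v h_M`, `v v`, the columns `h_T`, `h_M`, `v`. -/
structure CurvatureTableOne (τ : Fin p) (z : Jet p n) : Prop where
  TT_T : curv A (S.δT τ) (S.δT τ) (S.δT τ) z = 0
  TT_X : ∀ i, curv A (S.δT τ) (S.δT τ) (S.δX i) z = 0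
  TT_V : ∀ i, curv A (S.δT τ) (S.δT τ) (S.δV i τ) z = 0
  XT_T : ∀ k, curv A (S.δX k) (S.δT τ) (S.δT τ) z = 0
  XT_X : ∀ k i, curv A (S.δX k) (S.δT τ) (S.δX i) z
    = ∑ l, S.oneRTX A τ l i k z • S.δX l z
  XT_V : ∀ k i, curv A (S.δX k) (S.δT τ) (S.δV i τ) z
    = ∑ l, S.oneRTX A τ l i k z • S.δV l τ z
  XX_T : ∀ k j, curv A (S.δX k) (S.δX j) (S.δT τ) z = 0
  XX_X : ∀ k j i, curv A (S.δX k) (S.δX j) (S.δX i) z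
    = ∑ l, S.oneRXX A τ l i j k z • S.δX l z
  XX_V : ∀ k j i, curv A (S.δX k) (S.δX j) (S.δV i τ) z
    = ∑ l, S.oneRXX A τ l i j k z • S.δV l τ z
  VT_T : ∀ k, curv A (S.δV k τ) (S.δT τ) (S.δT τ) z = 0
  VT_X : ∀ k i, curv A (S.δV k τ) (S.δT τ) (S.δX i) z
    = ∑ l, S.onePT A τ l i k z • S.δX l z
  VT_V : ∀ k i, curv A (S.δV k τ) (S.δT τ) (S.δV i τ) z
    = ∑ l, S.onePT A τ l i k z • S.δV l τ z
  VX_T : ∀ k j, curv A (S.δV k τ) (S.δX j) (S.δT τ) z = 0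
  VX_X : ∀ k j i, curv A (S.δV k τ) (S.δX j) (S.δX i) z
    = ∑ l, S.onePX A τ l i j k z • S.δX l z
  VX_V : ∀ k j i, curv A (S.δV k τ) (S.δX j) (S.δV i τ) z
    = ∑ l, S.onePX A τ l i j k z • S.δV l τ z
  VV_T : ∀ k j, curv A (S.δV k τ) (S.δV j τ) (S.δT τ) z = 0
  VV_X : ∀ k j i, curv A (S.δV k τ) (S.δV j τ) (S.δX i) z
    = ∑ l, S.oneS A τ l i j k z • S.δX l z
  VV_V : ∀ k j i, curv A (S.δV k τ) (S.δV j τ) (S.δV i τ) z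
    = ∑ l, S.oneS A τ l i j k z • S.δV l τ z

/-- The table of the curvature d-tensor at the point `z` for `p ≥ 2`. -/
structure CurvatureTableMulti (z : Jet p n) : Prop where
  TT_T : ∀ γ β η, curv A (S.δT γ) (S.δT β) (S.δT η) z
    = ∑ α, S.Hcurv α η β γ z.1 • S.δT α z
  TT_X : ∀ γ β i, curv A (S.δT γ) (S.δT β) (S.δX i) z
    = ∑ l, S.multiRTT A l i β γ z • S.δX l z
  TT_V : ∀ γ β i α, curv A (S.δT γ) (S.δT β) (S.δV i α) z
    = ∑ l, ∑ η, (kron α η * S.multiRTT A l i β γ z - kron l i * S.Hcurv α η β γ z.1)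
        • S.δV l η z
  XT_T : ∀ k β η, curv A (S.δX k) (S.δT β) (S.δT η) z = 0
  XT_X : ∀ k β i, curv A (S.δX k) (S.δT β) (S.δX i) z
    = ∑ l, S.multiRTX A l i β k z • S.δX l z
  XT_V : ∀ k β i α, curv A (S.δX k) (S.δT β) (S.δV i α) z
    = ∑ l, ∑ η, (kron α η * S.multiRTX A l i β k z) • S.δV l η z
  XX_T : ∀ k j η, curv A (S.δX k) (S.δX j) (S.δT η) z = 0
  XX_X : ∀ k j i, curv A (S.δX k) (S.δX j) (S.δX i) z
    = ∑ l, S.r l i j k z • S.δX l z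
  XX_V : ∀ k j i α, curv A (S.δX k) (S.δX j) (S.δV i α) z
    = ∑ l, ∑ η, (kron α η * S.r l i j k z) • S.δV l η z
  VT_T : ∀ k γ β η, curv A (S.δV k γ) (S.δT β) (S.δT η) z = 0
  VT_X : ∀ k γ β i, curv A (S.δV k γ) (S.δT β) (S.δX i) z = 0
  VT_V : ∀ k γ β i α, curv A (S.δV k γ) (S.δT β) (S.δV i α) z = 0
  VX_T : ∀ k γ j η, curv A (S.δV k γ) (S.δX j) (S.δT η) z = 0
  VX_X : ∀ k γ j i, curv A (S.δV k γ) (S.δX j) (S.δX i) z = 0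
  VX_V : ∀ k γ j i α, curv A (S.δV k γ) (S.δX j) (S.δV i α) z = 0
  VV_T : ∀ k γ j β η, curv A (S.δV k γ) (S.δV j β) (S.δT η) z = 0
  VV_X : ∀ k γ j β i, curv A (S.δV k γ) (S.δV j β) (S.δX i) z = 0
  VV_V : ∀ k γ j β i α, curv A (S.δV k γ) (S.δV j β) (S.δV i α) z = 0

end LocalData

/-! ## Metrical multi-time Lagrange spaces -/

section Manifolds

variable {T : Type*} [TopologicalSpace T] [ChartedSpace (Fin p → ℝ) T]
  {M : Type*} [TopologicalSpace M] [ChartedSpace (Fin n → ℝ) M]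

/-- The fibre of `J¹(T, M)` over `(t, x)`: the linear maps `T_t T → T_x M`. -/
abbrev JetFibre (p n : ℕ) {T : Type*} [TopologicalSpace T] [ChartedSpace (Fin p → ℝ) T]
    {M : Type*} [TopologicalSpace M] [ChartedSpace (Fin n → ℝ) M] (t : T) (x : M) : Type :=
  TangentSpace 𝓘(ℝ, Fin p → ℝ) t →L[ℝ] TangentSpace 𝓘(ℝ, Fin n → ℝ) x

/-- The coordinate vector `∂/∂t^α` of the chart `φ` at the point with coordinates `t`. -/
def coordT (φ : OpenPartialHomeomorph T (Fin p → ℝ)) (t : Fin p → ℝ) (α : Fin p) :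
    TangentSpace 𝓘(ℝ, Fin p → ℝ) (φ.symm t) :=
  mfderiv 𝓘(ℝ, Fin p → ℝ) 𝓘(ℝ, Fin p → ℝ) φ.symm t (Pi.single α (1 : ℝ) : Fin p → ℝ)

/-- The coordinate vector `∂/∂x^i` of the chart `ψ` at the point with coordinates `x`. -/
def coordX (ψ : OpenPartialHomeomorph M (Fin n → ℝ)) (x : Fin n → ℝ) (i : Fin n) :
    TangentSpace 𝓘(ℝ, Fin n → ℝ) (ψ.symm x) :=
  mfderiv 𝓘(ℝ, Fin n → ℝ) 𝓘(ℝ, Fin n → ℝ) ψ.symm x (Pi.single i (1 : ℝ) : Fin n → ℝ)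

/-- The jet with coordinates `z = (t, x, v)`: the linear map `∂/∂t^α ↦ ∑ i, v i α • ∂/∂x^i`. -/
def jetOf (φ : OpenPartialHomeomorph T (Fin p → ℝ)) (ψ : OpenPartialHomeomorph M (Fin n → ℝ))
    (z : Jet p n) : JetFibre p n (φ.symm z.1) (ψ.symm z.2.1) :=
  (mfderiv 𝓘(ℝ, Fin n → ℝ) 𝓘(ℝ, Fin n → ℝ) ψ.symm z.2.1).comp
    ((LinearMap.toContinuousLinearMap (Matrix.toLin' (Matrix.of z.2.2))).comp
      (mfderiv 𝓘(ℝ, Fin p → ℝ) 𝓘(ℝ, Fin p → ℝ) φ (φ.symm z.1)))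

/-- The local expression of `(h, g, L)` in the charts `φ`, `ψ`. -/
def localData
    (h : ∀ t : T, TangentSpace 𝓘(ℝ, Fin p → ℝ) t →L[ℝ] TangentSpace 𝓘(ℝ, Fin p → ℝ) t →L[ℝ] ℝ)
    (g : ∀ (t : T) (x : M), JetFibre p n t x →
      TangentSpace 𝓘(ℝ, Fin n → ℝ) x →L[ℝ] TangentSpace 𝓘(ℝ, Fin n → ℝ) x →L[ℝ] ℝ)
    (L : ∀ (t : T) (x : M), JetFibre p n t x → ℝ)
    (φ : OpenPartialHomeomorph T (Fin p → ℝ)) (ψ : OpenPartialHomeomorph M (Fin n → ℝ)) :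
    LocalData p n where
  U := φ.target
  V := ψ.target
  h α β t := h (φ.symm t) (coordT φ t α) (coordT φ t β)
  g i j z := g (φ.symm z.1) (ψ.symm z.2.1) (jetOf φ ψ z) (coordX ψ z.2.1 i) (coordX ψ z.2.1 j)
  L z := L (φ.symm z.1) (ψ.symm z.2.1) (jetOf φ ψ z)

end Manifolds

/-- A metrical multi-time Lagrange space over the manifolds `T`, `M`: a smooth, symmetric,
nondegenerate temporal metric `h` on `T`, a smooth, symmetric, nondegenerate d-tensor `g` on
`J¹(T, M)` and a smooth function `L` on `J¹(T, M)` with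
`(1/2) ∂²L/∂x^i_α∂x^j_β = h^{αβ} g_{ij}` in all local coordinates. -/
structure MetricalLagrangeSpace (p n : ℕ)
    (T : Type*) [TopologicalSpace T] [ChartedSpace (Fin p → ℝ) T]
    (M : Type*) [TopologicalSpace M] [ChartedSpace (Fin n → ℝ) M] where
  h : ∀ t : T, TangentSpace 𝓘(ℝ, Fin p → ℝ) t →L[ℝ] TangentSpace 𝓘(ℝ, Fin p → ℝ) t →L[ℝ] ℝ
  g : ∀ (t : T) (x : M), JetFibre p n t x →
    TangentSpace 𝓘(ℝ, Fin n → ℝ) x →L[ℝ] TangentSpace 𝓘(ℝ, Fin n → ℝ) x →L[ℝ] ℝ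
  L : ∀ (t : T) (x : M), JetFibre p n t x → ℝ
  h_symm : ∀ t u w, h t u w = h t w u
  h_nondeg : ∀ t u, (∀ w, h t u w = 0) → u = 0
  g_symm : ∀ t x a u w, g t x a u w = g t x a w u
  g_nondeg : ∀ t x a u, (∀ w, g t x a u w = 0) → u = 0
  h_smooth : ∀ φ ∈ IsManifold.maximalAtlas 𝓘(ℝ, Fin p → ℝ) ∞ T,
    ∀ ψ ∈ IsManifold.maximalAtlas 𝓘(ℝ, Fin n → ℝ) ∞ M,
    ∀ α β, ContDiffOn ℝ ∞ ((localData h g L φ ψ).h α β) φ.target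
  g_smooth : ∀ φ ∈ IsManifold.maximalAtlas 𝓘(ℝ, Fin p → ℝ) ∞ T,
    ∀ ψ ∈ IsManifold.maximalAtlas 𝓘(ℝ, Fin n → ℝ) ∞ M,
    ∀ i j, ContDiffOn ℝ ∞ ((localData h g L φ ψ).g i j) (localData h g L φ ψ).dom
  L_smooth : ∀ φ ∈ IsManifold.maximalAtlas 𝓘(ℝ, Fin p → ℝ) ∞ T,
    ∀ ψ ∈ IsManifold.maximalAtlas 𝓘(ℝ, Fin n → ℝ) ∞ M,
    ContDiffOn ℝ ∞ (localData h g L φ ψ).L (localData h g L φ ψ).dom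
  regular : ∀ φ ∈ IsManifold.maximalAtlas 𝓘(ℝ, Fin p → ℝ) ∞ T,
    ∀ ψ ∈ IsManifold.maximalAtlas 𝓘(ℝ, Fin n → ℝ) ∞ M,
    ∀ z ∈ (localData h g L φ ψ).dom, ∀ i j α β,
      (1 / 2) * pdV i α (pdV j β (localData h g L φ ψ).L) z
        = (localData h g L φ ψ).hInv α β z.1 * (localData h g L φ ψ).g i j z

/-- The local expression of the space in the charts `φ`, `ψ`. -/
def MetricalLagrangeSpace.inChart
    {T : Type*} [TopologicalSpace T] [ChartedSpace (Fin p → ℝ) T]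
    {M : Type*} [TopologicalSpace M] [ChartedSpace (Fin n → ℝ) M]
    (E : MetricalLagrangeSpace p n T M)
    (φ : OpenPartialHomeomorph T (Fin p → ℝ)) (ψ : OpenPartialHomeomorph M (Fin n → ℝ)) :
    LocalData p n :=
  localData E.h E.g E.L φ ψ

end MultiTime

end

open scoped ContDiff Manifold

namespace MultiTime

variable {p n : ℕ}

namespace LocalData

/-! Everything is a computation with connection forms in the adapted frame of one chart; `Regular`
collects what the chart inherits from the manifold. The nonlinear connection enters only through the
smoothness of `M` and `N`.

Uniqueness. Parallel projections mean that `∇` is block diagonal in the frame, with one matrix of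
forms for each distribution. The `h_T` block is prescribed to be the Levi-Civita form of `h`
(`formT`). Call the `h_M` block `formX`. Since `J` identifies `v` with `h_M ⊗ h_T*` through `h`, and
`h` is parallel, `∇J = 0` forces the `v` block to be `formX ⊗ 1 - 1 ⊗ formT` (`IsHNormal.cov_δV`).
In `formX` the coefficient `G` is prescribed, while `L` and, for each fixed temporal index, `C` are
symmetric and make `g` parallel; the Koszul permutation argument identifies them with
Christoffel-type symbols (`eq_christoffel`). That argument needs no commutation of the derivations,
so it applies to the non-holonomic fields `δ/δx^k`.

Existence. These forms define a connection (`adaptedConn`). Its covariant derivative in frame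
components (`Adapted.cov_eq`) shows that every axiom holds.

Curvature. On a block with connection form `ω` the curvature is `dω + ω ∧ ω` (`curv_of_block`). The
frame fields have constant components along `∂/∂t`, `∂/∂x`, so their brackets are vertical: `formT`
vanishes on the brackets, and `formX` sees them only through `C` times derivatives of `M` and `N`.
On `v` the mixed terms cancel and the curvature is that of a tensor product with a dual
(`Adapted.curv_δV`). For `p = 1` the table is this general formula with one temporal index.

For `p ≥ 2` there is a rigidity phenomenon. Third vertical derivatives of `L` are symmetric, so
`h^{αβ} ∂g_{ij}/∂x^k_γ = h^{γβ} ∂g_{kj}/∂x^i_α`. Contracting with `h_{βα}` gives `p ∂g_{ij}/∂x^k_γ =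
∂g_{kj}/∂x^i_γ`; applying this twice multiplies by `p²`, so the derivative vanishes
(`Regular.pdV_g_eq_zero`). Hence `C = 0`, `L = Γ`, and `G`, `Γ` are constant on the fibres, which
kills all vertical components of the curvature. -/

/-- The local conditions satisfied by a metrical multi-time Lagrange space in a chart. -/
structure Regular (S : LocalData p n) : Prop where
  isOpen_U : IsOpen S.U
  isOpen_V : IsOpen S.V
  h_smooth : ∀ α β, ContDiffOn ℝ ∞ (S.h α β) S.U
  g_smooth : ∀ i j, ContDiffOn ℝ ∞ (S.g i j) S.dom
  L_smooth : ContDiffOn ℝ ∞ S.L S.dom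
  h_symm : ∀ t α β, S.h α β t = S.h β α t
  g_symm : ∀ z i j, S.g i j z = S.g j i z
  h_det : ∀ t ∈ S.U, (Matrix.of fun a b => S.h a b t).det ≠ 0
  g_det : ∀ z ∈ S.dom, (Matrix.of fun a b => S.g a b z).det ≠ 0
  hessian : ∀ z ∈ S.dom, ∀ i j α β,
    (1 / 2) * pdV i α (pdV j β S.L) z = S.hInv α β z.1 * S.g i j z

end LocalData

/-! ### Smooth dependence of determinants and inverse matrices -/

section Smooth

variable {E : Type*} [NormedAddCommGroup E] [NormedSpace ℝ E] {s : Set E}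

theorem contDiffOn_det {m : ℕ} {f : Fin m → Fin m → E → ℝ}
    (hf : ∀ i j, ContDiffOn ℝ ∞ (f i j) s) :
    ContDiffOn ℝ ∞ (fun z => (Matrix.of fun a b => f a b z).det) s := by
  simp only [Matrix.det_apply, Matrix.of_apply]
  refine ContDiffOn.sum fun σ _ => ?_
  refine ContDiffOn.const_smul _ ?_
  exact contDiffOn_prod fun i _ => hf _ _

/-- Cramer's rule: the entries of the inverse are cofactors divided by the determinant, and a
cofactor is the determinant of the matrix with one row replaced by a basis vector. -/
theorem contDiffOn_matrix_inv {m : ℕ} {f : Fin m → Fin m → E → ℝ}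
    (hf : ∀ i j, ContDiffOn ℝ ∞ (f i j) s)
    (hd : ∀ z ∈ s, (Matrix.of fun a b => f a b z).det ≠ 0) (i j : Fin m) :
    ContDiffOn ℝ ∞ (fun z => (Matrix.of fun a b => f a b z)⁻¹ i j) s := by
  simp only [Matrix.inv_def, Matrix.smul_apply, Ring.inverse_eq_inv', smul_eq_mul,
    Matrix.adjugate_apply]
  refine ((contDiffOn_det hf).inv hd).mul ?_
  have : ∀ z, (Matrix.of fun a b => f a b z).updateRow j (Pi.single i 1)
      = Matrix.of fun a b => (if a = j then fun _ => (Pi.single i (1 : ℝ) : Fin m → ℝ) b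
          else f a b) z := by
    intro z
    ext a b
    by_cases h : a = j
    · subst h; simp
    · simp [h]
  simp only [this]
  refine contDiffOn_det fun a b => ?_
  by_cases h : a = j
  · simp only [h, if_true]; exact contDiffOn_const
  · simpa only [h, if_false] using hf a b

theorem mul_matrix_inv_apply {m : ℕ} {f : Fin m → Fin m → ℝ}
    (hd : (Matrix.of f).det ≠ 0) (i j : Fin m) :
    ∑ k, f i k * (Matrix.of f)⁻¹ k j = kron i j := by
  have := congrFun (congrFun (Matrix.mul_nonsing_inv (Matrix.of f) (isUnit_iff_ne_zero.2 hd)) i) j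
  simpa [Matrix.mul_apply, Matrix.one_apply, kron] using this

theorem matrix_inv_mul_apply {m : ℕ} {f : Fin m → Fin m → ℝ}
    (hd : (Matrix.of f).det ≠ 0) (i j : Fin m) :
    ∑ k, (Matrix.of f)⁻¹ i k * f k j = kron i j := by
  have := congrFun (congrFun (Matrix.nonsing_inv_mul (Matrix.of f) (isUnit_iff_ne_zero.2 hd)) i) j
  simpa [Matrix.mul_apply, Matrix.one_apply, kron] using this

end Smooth

/-! ### Sums against the Kronecker symbol -/

@[simp] theorem kron_self {ι : Type} [DecidableEq ι] (a : ι) : kron a a = 1 := by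
  simp [kron]

@[simp] theorem sum_kron_mul {ι : Type} [Fintype ι] [DecidableEq ι] (a : ι) (f : ι → ℝ) :
    ∑ b, kron a b * f b = f a := by
  simp [kron]

@[simp] theorem sum_kron_mul' {ι : Type} [Fintype ι] [DecidableEq ι] (a : ι) (f : ι → ℝ) :
    ∑ b, kron b a * f b = f a := by
  simp [kron]

@[simp] theorem sum_mul_kron {ι : Type} [Fintype ι] [DecidableEq ι] (a : ι) (f : ι → ℝ) :
    ∑ b, f b * kron a b = f a := by
  simp [kron]

@[simp] theorem sum_mul_kron' {ι : Type} [Fintype ι] [DecidableEq ι] (a : ι) (f : ι → ℝ) :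
    ∑ b, f b * kron b a = f a := by
  simp [kron]

@[simp] theorem sum_kron_smul' {ι E : Type} [Fintype ι] [DecidableEq ι] [AddCommGroup E]
    [Module ℝ E] (a : ι) (f : ι → E) : ∑ b, kron b a • f b = f a := by
  simp [kron]

/-! ### Smoothness of the canonical objects in a chart -/

namespace LocalData

variable {S : LocalData p n} (hS : S.Regular)
include hS

namespace Regular

theorem isOpen_dom : IsOpen S.dom :=
  (hS.isOpen_U.preimage continuous_fst).inter
    (hS.isOpen_V.preimage (continuous_fst.comp continuous_snd))

theorem dom_mem_nhds {z : Jet p n} (hz : z ∈ S.dom) : S.dom ∈ nhds z :=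
  hS.isOpen_dom.mem_nhds hz

theorem differentiableAt {E : Type*} [NormedAddCommGroup E] [NormedSpace ℝ E]
    {f : Jet p n → E} (hf : ContDiffOn ℝ ∞ f S.dom) {z : Jet p n} (hz : z ∈ S.dom) :
    DifferentiableAt ℝ f z :=
  (hf.contDiffAt (hS.dom_mem_nhds hz)).differentiableAt (by simp)

theorem contDiffOn_fderiv {E : Type*} [NormedAddCommGroup E] [NormedSpace ℝ E]
    {f : Jet p n → E} (hf : ContDiffOn ℝ ∞ f S.dom) : ContDiffOn ℝ ∞ (fderiv ℝ f) S.dom :=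
  hf.fderiv_of_isOpen hS.isOpen_dom (by simp)

theorem contDiffOn_along {X : Jet p n → Jet p n} {f : Jet p n → ℝ}
    (hX : ContDiffOn ℝ ∞ X S.dom) (hf : ContDiffOn ℝ ∞ f S.dom) :
    ContDiffOn ℝ ∞ (along X f) S.dom :=
  (hS.contDiffOn_fderiv hf).clm_apply hX

theorem contDiffOn_pdT {f : Jet p n → ℝ} (α : Fin p) (hf : ContDiffOn ℝ ∞ f S.dom) :
    ContDiffOn ℝ ∞ (pdT α f) S.dom := hS.contDiffOn_along contDiffOn_const hf

theorem contDiffOn_pdX {f : Jet p n → ℝ} (i : Fin n) (hf : ContDiffOn ℝ ∞ f S.dom) :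
    ContDiffOn ℝ ∞ (pdX i f) S.dom := hS.contDiffOn_along contDiffOn_const hf

theorem contDiffOn_pdV {f : Jet p n → ℝ} (i : Fin n) (α : Fin p) (hf : ContDiffOn ℝ ∞ f S.dom) :
    ContDiffOn ℝ ∞ (pdV i α f) S.dom := hS.contDiffOn_along contDiffOn_const hf

theorem contDiffOn_pd {f : (Fin p → ℝ) → ℝ} (α : Fin p) (hf : ContDiffOn ℝ ∞ f S.U) :
    ContDiffOn ℝ ∞ (pd α f) S.U :=
  (hf.fderiv_of_isOpen hS.isOpen_U (by simp)).clm_apply contDiffOn_const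

theorem contDiffOn_hInv (α β : Fin p) : ContDiffOn ℝ ∞ (S.hInv α β) S.U :=
  contDiffOn_matrix_inv hS.h_smooth hS.h_det α β

theorem contDiffOn_gInv (i j : Fin n) : ContDiffOn ℝ ∞ (S.gInv i j) S.dom :=
  contDiffOn_matrix_inv hS.g_smooth hS.g_det i j

omit hS in
theorem contDiffOn_comp_fst {f : (Fin p → ℝ) → ℝ} (hf : ContDiffOn ℝ ∞ f S.U) :
    ContDiffOn ℝ ∞ (fun z : Jet p n => f z.1) S.dom :=
  hf.comp contDiff_fst.contDiffOn fun _ hz => hz.1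

theorem contDiffOn_H (γ α β : Fin p) : ContDiffOn ℝ ∞ (S.H γ α β) S.U := by
  refine ContDiffOn.sum fun μ _ => ?_
  exact ((hS.contDiffOn_hInv γ μ).div_const _).mul
    (((hS.contDiffOn_pd _ (hS.h_smooth _ _)).add (hS.contDiffOn_pd _ (hS.h_smooth _ _))).sub
      (hS.contDiffOn_pd _ (hS.h_smooth _ _)))

theorem contDiffOn_Chr (l j k : Fin n) : ContDiffOn ℝ ∞ (S.Chr l j k) S.dom := by
  refine ContDiffOn.sum fun μ _ => ?_
  exact ((hS.contDiffOn_gInv l μ).div_const _).mul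
    (((hS.contDiffOn_pdX _ (hS.g_smooth _ _)).add (hS.contDiffOn_pdX _ (hS.g_smooth _ _))).sub
      (hS.contDiffOn_pdX _ (hS.g_smooth _ _)))

omit hS in
theorem contDiffOn_coordV (i : Fin n) (α : Fin p) :
    ContDiffOn ℝ ∞ (fun z : Jet p n => z.2.2 i α) S.dom :=
  ContDiff.contDiffOn (by fun_prop)

theorem contDiffOn_spray (k : Fin n) : ContDiffOn ℝ ∞ (S.spray k) S.dom := by
  have hL := hS.L_smooth
  refine contDiffOn_const.mul (ContDiffOn.sum fun i _ => ?_)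
  refine ((hS.contDiffOn_gInv _ _).div_const _).mul ?_
  refine ((((?_ : ContDiffOn _ _ _ _).sub (hS.contDiffOn_pdX _ hL)).add ?_).add ?_).add
    (contDiffOn_const.mul ?_)
  · exact ContDiffOn.sum fun j _ => ContDiffOn.sum fun α _ =>
      (hS.contDiffOn_pdX _ (hS.contDiffOn_pdV _ _ hL)).mul (contDiffOn_coordV _ _)
  · exact ContDiffOn.sum fun α _ => hS.contDiffOn_pdT _ (hS.contDiffOn_pdV _ _ hL)
  · exact ContDiffOn.sum fun α _ => ContDiffOn.sum fun γ _ =>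
      (hS.contDiffOn_pdV _ _ hL).mul (contDiffOn_comp_fst (hS.contDiffOn_H _ _ _))
  · exact ContDiffOn.sum fun j _ => ContDiffOn.sum fun α _ => ContDiffOn.sum fun β _ =>
      ContDiffOn.sum fun γ _ => (((hS.g_smooth _ _).mul
        (contDiffOn_comp_fst (hS.contDiffOn_hInv _ _))).mul
        (contDiffOn_comp_fst (hS.contDiffOn_H _ _ _))).mul (contDiffOn_coordV _ _)

theorem contDiffOn_M (i : Fin n) (α β : Fin p) : ContDiffOn ℝ ∞ (S.M i α β) S.dom :=
  (ContDiffOn.sum fun _ _ => (contDiffOn_comp_fst (hS.contDiffOn_H _ _ _)).mul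
    (contDiffOn_coordV _ _)).neg

theorem contDiffOn_N (i : Fin n) (α : Fin p) (j : Fin n) : ContDiffOn ℝ ∞ (S.N i α j) S.dom :=
  ContDiffOn.sum fun _ _ => (hS.contDiffOn_pdV _ _ (hS.contDiffOn_spray _)).mul
    (contDiffOn_comp_fst (hS.h_smooth _ _))

theorem smooth_δT (α : Fin p) : S.SmoothField (S.δT α) :=
  contDiffOn_const.sub (ContDiffOn.sum fun _ _ => ContDiffOn.sum fun _ _ =>
    (hS.contDiffOn_M _ _ _).smul contDiffOn_const)

theorem smooth_δX (i : Fin n) : S.SmoothField (S.δX i) :=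
  contDiffOn_const.sub (ContDiffOn.sum fun _ _ => ContDiffOn.sum fun _ _ =>
    (hS.contDiffOn_N _ _ _).smul contDiffOn_const)

omit hS in
theorem smooth_δV (i : Fin n) (α : Fin p) : S.SmoothField (S.δV i α) :=
  contDiffOn_const

end Regular

end LocalData

/-! ### Calculus of linear connections -/

section Cov

variable (A : LinConn p n)

theorem cov_congr {X Y Y' : Jet p n → Jet p n} {z : Jet p n} (h : Y =ᶠ[nhds z] Y') :
    cov A X Y z = cov A X Y' z := by
  simp [cov, h.fderiv_eq, h.eq_of_nhds]

theorem cov_sum_smul {κ : Type*} [Fintype κ] {X : Jet p n → Jet p n}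
    {f : κ → Jet p n → ℝ} {e : κ → Jet p n → Jet p n} {z : Jet p n}
    (hf : ∀ c, DifferentiableAt ℝ (f c) z) (he : ∀ c, DifferentiableAt ℝ (e c) z) :
    cov A X (fun w => ∑ c, f c w • e c w) z
      = ∑ c, (along X (f c) z • e c z + f c z • cov A X (e c) z) := by
  simp only [cov, along]
  rw [fderiv_fun_sum fun c _ => (hf c).fun_smul (he c)]
  simp only [sum_apply, map_sum, map_smul, ← Finset.sum_add_distrib]
  refine Finset.sum_congr rfl fun c _ => ?_
  rw [fderiv_fun_smul (hf c) (he c)]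
  simp only [add_apply, smul_apply,
    ContinuousLinearMap.smulRight_apply, smul_add]
  abel

theorem cov_add {X Y Y' : Jet p n → Jet p n} {z : Jet p n}
    (hY : DifferentiableAt ℝ Y z) (hY' : DifferentiableAt ℝ Y' z) :
    cov A X (fun w => Y w + Y' w) z = cov A X Y z + cov A X Y' z := by
  simp only [cov, fderiv_fun_add hY hY', add_apply, map_add]
  abel

/-- The curvature on a family of vector fields whose span is preserved by `∇_X`, `∇_Y` and
`∇_{[X, Y]}`. -/
theorem curv_of_block {κ : Type*} [Fintype κ] {X Y : Jet p n → Jet p n}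
    {e : κ → Jet p n → Jet p n} {D : Set (Jet p n)} {z : Jet p n} (hz : D ∈ nhds z)
    {a b : κ → κ → Jet p n → ℝ} {c : κ → κ → ℝ}
    (ha : ∀ j, ∀ w ∈ D, cov A X (e j) w = ∑ k, a k j w • e k w)
    (hb : ∀ j, ∀ w ∈ D, cov A Y (e j) w = ∑ k, b k j w • e k w)
    (hc : ∀ j, cov A (VectorField.lieBracket ℝ X Y) (e j) z = ∑ k, c k j • e k z)
    (hda : ∀ k j, DifferentiableAt ℝ (a k j) z) (hdb : ∀ k j, DifferentiableAt ℝ (b k j) z)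
    (he : ∀ k, DifferentiableAt ℝ (e k) z) (j : κ) :
    curv A X Y (e j) z = ∑ k, (along X (b k j) z - along Y (a k j) z
      + ∑ m, (b m j z * a k m z - a m j z * b k m z) - c k j) • e k z := by
  have hz' := mem_of_mem_nhds hz
  -- One formula serves both orders of differentiation: the matrix product arises when `∇_X` falls
  -- on the frame inside `∇_Y e_j`. Since `∇_Y e_j` gets differentiated, its expansion is needed on
  -- a neighbourhood; the one along the bracket only at `z`.
  have key : ∀ (X Y : Jet p n → Jet p n) (a b : κ → κ → Jet p n → ℝ),
      (∀ j, ∀ w ∈ D, cov A X (e j) w = ∑ k, a k j w • e k w) →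
      (∀ j, ∀ w ∈ D, cov A Y (e j) w = ∑ k, b k j w • e k w) →
      (∀ k j, DifferentiableAt ℝ (b k j) z) →
      cov A X (cov A Y (e j)) z
        = ∑ k, (along X (b k j) z + ∑ m, b m j z * a k m z) • e k z := by
    intro X Y a b ha hb hdb
    have : cov A Y (e j) =ᶠ[nhds z] fun w => ∑ k, b k j w • e k w :=
      Filter.eventually_of_mem hz (hb j)
    rw [cov_congr A this, cov_sum_smul A (fun c => hdb c j) he]
    simp only [ha _ z hz', Finset.sum_add_distrib, add_smul, Finset.sum_smul, Finset.smul_sum,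
      smul_smul]
    congr 1
    rw [Finset.sum_comm]
  rw [curv, key X Y a b ha hb hdb, key Y X b a hb ha hda, hc, ← Finset.sum_sub_distrib,
    ← Finset.sum_sub_distrib]
  refine Finset.sum_congr rfl fun k _ => ?_
  rw [← sub_smul, ← sub_smul, Finset.sum_sub_distrib]
  congr 1
  ring

end Cov

/-! ### The adapted frame and its dual -/

namespace LocalData

variable (S : LocalData p n)

@[simp] theorem dt_δT (α β : Fin p) (z : Jet p n) : S.dt α (S.δT β z) = kron α β := by
  simp [dt, δT, eT, eV, kron, Prod.fst_sum, Pi.single_apply]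

@[simp] theorem dx_δT (i : Fin n) (β : Fin p) (z : Jet p n) : S.dx i (S.δT β z) = 0 := by
  simp [dx, δT, eT, eV, Prod.fst_sum, Prod.snd_sum]

@[simp] theorem dt_δX (α : Fin p) (i : Fin n) (z : Jet p n) : S.dt α (S.δX i z) = 0 := by
  simp [dt, δX, eX, eV, Prod.fst_sum]

@[simp] theorem dx_δX (i j : Fin n) (z : Jet p n) : S.dx i (S.δX j z) = kron i j := by
  simp [dx, δX, eX, eV, kron, Prod.fst_sum, Prod.snd_sum, Pi.single_apply]

@[simp] theorem dt_δV (α : Fin p) (i : Fin n) (β : Fin p) (z : Jet p n) :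
    S.dt α (S.δV i β z) = 0 := by
  simp [dt, δV, eV]

@[simp] theorem dx_δV (j i : Fin n) (β : Fin p) (z : Jet p n) : S.dx j (S.δV i β z) = 0 := by
  simp [dx, δV, eV]

theorem eV_apply (j i : Fin n) (β α : Fin p) :
    (eV j β : Jet p n).2.2 i α = kron i j * kron α β := by
  by_cases h : i = j
  · subst h
    simp [eV, kron, Pi.single_apply]
  · simp [eV, kron, h]

theorem δT_vert (β : Fin p) (z : Jet p n) (i : Fin n) (α : Fin p) :
    (S.δT β z).2.2 i α = -S.M i α β z := by
  simp [δT, eT, Prod.snd_sum, Finset.sum_apply, eV_apply, ← mul_assoc]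

theorem δX_vert (j : Fin n) (z : Jet p n) (i : Fin n) (α : Fin p) :
    (S.δX j z).2.2 i α = -S.N i α j z := by
  simp [δX, eX, Prod.snd_sum, Finset.sum_apply, eV_apply, ← mul_assoc]

@[simp] theorem dv_δT (i : Fin n) (α β : Fin p) (z : Jet p n) : S.dv i α z (S.δT β z) = 0 := by
  have h1 : ∀ γ, (S.δT β z).1 γ = kron γ β := fun γ => S.dt_δT γ β z
  have h2 : ∀ j, (S.δT β z).2.1 j = 0 := fun j => S.dx_δT j β z
  simp [dv, δT_vert, h1, h2]

@[simp] theorem dv_δX (i : Fin n) (α : Fin p) (j : Fin n) (z : Jet p n) :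
    S.dv i α z (S.δX j z) = 0 := by
  have h1 : ∀ γ, (S.δX j z).1 γ = 0 := fun γ => S.dt_δX γ j z
  have h2 : ∀ k, (S.δX j z).2.1 k = kron k j := fun k => S.dx_δX k j z
  simp [dv, δX_vert, h1, h2]

@[simp] theorem dv_δV (i : Fin n) (α : Fin p) (j : Fin n) (β : Fin p) (z : Jet p n) :
    S.dv i α z (S.δV j β z) = kron i j * kron α β := by
  simp [dv, δV, eV_apply]
  simp [eV]

/-- Duality of frame and coframe. Only the vertical component needs work: the terms `-M`, `-N` in
`δT`, `δX` cancel the terms `+M`, `+N` in `dv`. -/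
theorem projT_add_projX_add_projV (z w : Jet p n) :
    S.projT z w + S.projX z w + S.projV z w = w := by
  refine Prod.ext ?_ (Prod.ext ?_ ?_)
  · ext α
    have h1 : ∀ β, (S.δT β z).1 α = kron α β := fun γ => S.dt_δT α γ z
    have h2 : ∀ β, (S.δX β z).1 α = 0 := fun γ => S.dt_δX α γ z
    have h3 : ∀ i β, (S.δV i β z).1 α = 0 := fun i γ => S.dt_δV α i γ z
    simp [projT, projX, projV, Prod.fst_sum, h1, h2, h3, dt]
  · ext i
    have h1 : ∀ β, (S.δT β z).2.1 i = 0 := fun γ => S.dx_δT i γ z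
    have h2 : ∀ j, (S.δX j z).2.1 i = kron i j := fun γ => S.dx_δX i γ z
    have h3 : ∀ j β, (S.δV j β z).2.1 i = 0 := fun j γ => S.dx_δV i j γ z
    simp [projT, projX, projV, Prod.fst_sum, Prod.snd_sum, h1, h2, h3, dx]
  · ext i α
    have h3 : ∀ j β, (S.δV j β z).2.2 i α = kron i j * kron α β := fun j β => eV_apply _ _ _ _
    simp [projT, projX, projV, Prod.snd_sum, δT_vert, δX_vert, h3, dx, dt, dv]
    simp only [mul_left_comm, ← Finset.mul_sum, sum_kron_mul, sum_mul_kron]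
    simp only [mul_comm]
    ring

/-- `dt^α` as a linear map. -/
def dtL (α : Fin p) : Jet p n →L[ℝ] ℝ :=
  (ContinuousLinearMap.proj α).comp (ContinuousLinearMap.fst ℝ _ _)

/-- `dx^i` as a linear map. -/
def dxL (i : Fin n) : Jet p n →L[ℝ] ℝ :=
  (ContinuousLinearMap.proj i).comp ((ContinuousLinearMap.fst ℝ _ _).comp
    (ContinuousLinearMap.snd ℝ _ _))

/-- The coordinate `w ↦ w^i_α` as a linear map. -/
def coordVL (i : Fin n) (α : Fin p) : Jet p n →L[ℝ] ℝ :=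
  (ContinuousLinearMap.proj α).comp ((ContinuousLinearMap.proj (R := ℝ)
    (φ := fun _ : Fin n => Fin p → ℝ) i).comp ((ContinuousLinearMap.snd ℝ _ _).comp
    (ContinuousLinearMap.snd ℝ _ _)))

/-- `δx^i_α` as a linear map. -/
noncomputable def dvL (i : Fin n) (α : Fin p) (z : Jet p n) : Jet p n →L[ℝ] ℝ :=
  coordVL i α + ∑ β, S.M i α β z • dtL β + ∑ j, S.N i α j z • dxL j

theorem dtL_apply (α : Fin p) (w : Jet p n) : dtL α w = S.dt α w := rfl

theorem dxL_apply (i : Fin n) (w : Jet p n) : dxL i w = S.dx i w := rfl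

theorem dvL_apply (i : Fin n) (α : Fin p) (z w : Jet p n) : S.dvL i α z w = S.dv i α z w := by
  simp [dvL, dv]
  rfl

@[simp] theorem projT_δT (α : Fin p) (z : Jet p n) : S.projT z (S.δT α z) = S.δT α z := by
  simp [projT]

@[simp] theorem projX_δX (i : Fin n) (z : Jet p n) : S.projX z (S.δX i z) = S.δX i z := by
  simp [projX]

end LocalData

/-! ### Christoffel symbols of a metric along a family of derivations -/

section Christoffel

variable {m : ℕ}

/-- The Christoffel symbols formed from the components `g i j` of a metric and the derivatives
`D k i j` of `g i j` in the direction `k`. -/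
noncomputable def christoffel (g : Fin m → Fin m → ℝ) (D : Fin m → Fin m → Fin m → ℝ)
    (l j k : Fin m) : ℝ :=
  ∑ i, (Matrix.of g)⁻¹ l i / 2 * (D k i j + D j i k - D i j k)

variable {g : Fin m → Fin m → ℝ} {D : Fin m → Fin m → Fin m → ℝ}

theorem christoffel_symm (hD : ∀ k i j, D k i j = D k j i) (l j k : Fin m) :
    christoffel g D l j k = christoffel g D l k j := by
  refine Finset.sum_congr rfl fun i _ => ?_
  rw [hD i j k]
  ring

theorem sum_mul_inv_mul (hd : (Matrix.of g).det ≠ 0) (i : Fin m) (f : Fin m → ℝ) :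
    ∑ l, g i l * ∑ k, (Matrix.of g)⁻¹ l k * f k = f i := by
  simp only [Finset.mul_sum]
  rw [Finset.sum_comm]
  simp only [← mul_assoc, ← Finset.sum_mul, mul_matrix_inv_apply hd, sum_kron_mul]

theorem sum_inv_mul_mul (hd : (Matrix.of g).det ≠ 0) (i : Fin m) (f : Fin m → ℝ) :
    ∑ l, (Matrix.of g)⁻¹ i l * ∑ k, g l k * f k = f i := by
  simp only [Finset.mul_sum]
  rw [Finset.sum_comm]
  simp only [← mul_assoc, ← Finset.sum_mul, matrix_inv_mul_apply hd, sum_kron_mul]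

theorem sum_mul_christoffel (hd : (Matrix.of g).det ≠ 0) (i j k : Fin m) :
    ∑ l, g i l * christoffel g D l j k = (D k i j + D j i k - D i j k) / 2 := by
  rw [← sum_mul_inv_mul hd i fun i => (D k i j + D j i k - D i j k) / 2]
  refine Finset.sum_congr rfl fun l _ => ?_
  rw [christoffel]
  congr 1
  refine Finset.sum_congr rfl fun l _ => ?_
  ring

/-- Lowering the index turns the two terms into Koszul expressions whose antisymmetric parts cancel.
`D` need only be symmetric in its metric indices, so the directions may be non-commuting fields. It
is used for `h` along `∂/∂t` and for `g` along `δ/δx` and along `∂/∂x^k_γ` with `γ` fixed. -/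
theorem christoffel_metric (hg : ∀ i j, g i j = g j i) (hd : (Matrix.of g).det ≠ 0)
    (hD : ∀ k i j, D k i j = D k j i) (i j k : Fin m) :
    ∑ l, (christoffel g D l i k * g l j + christoffel g D l j k * g i l) = D k i j := by
  simp only [Finset.sum_add_distrib, fun l => hg l j, fun a b => mul_comm (christoffel g D a b k)]
  rw [sum_mul_christoffel hd, sum_mul_christoffel hd, hD k j i, hD i j k, hD j i k]
  rw [hD i k j]
  ring

/-- The Christoffel symbols are the only symmetric coefficients for which the metric is
parallel. -/
theorem eq_christoffel (hg : ∀ i j, g i j = g j i) (hd : (Matrix.of g).det ≠ 0)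
    {Γ : Fin m → Fin m → Fin m → ℝ} (hΓ : ∀ l i j, Γ l i j = Γ l j i)
    (hm : ∀ i j k, D k i j = ∑ l, (Γ l i k * g l j + Γ l j k * g i l)) (l j k : Fin m) :
    Γ l j k = christoffel g D l j k := by
  rw [← sum_inv_mul_mul hd l fun l => Γ l j k, christoffel]
  refine Finset.sum_congr rfl fun i _ => ?_
  simp only [hm, Finset.sum_add_distrib]
  have h1 : ∀ a b c, ∑ x, Γ x a b * g x c = ∑ x, g c x * Γ x a b := fun a b c =>
    Finset.sum_congr rfl fun x _ => by rw [hg x c, mul_comm]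
  have h2 : ∀ a b c, ∑ x, Γ x a b * g c x = ∑ x, g c x * Γ x a b := fun a b c =>
    Finset.sum_congr rfl fun x _ => by rw [mul_comm]
  have h3 : ∀ a b c, ∑ x, g c x * Γ x a b = ∑ x, g c x * Γ x b a := fun a b c =>
    Finset.sum_congr rfl fun x _ => by rw [hΓ]
  simp only [h1, h2]
  -- The Koszul permutation: after this use of the symmetry of `Γ`, four of the six sums cancel in
  -- pairs and the other two agree.
  rw [h3 k j i, h3 i j k, h3 i k j]
  ring

end Christoffel

/-! ### Connection forms, and what the axioms force on them -/

/-- `X ↦ ∇_X Y` at a point, as a linear map. -/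
noncomputable def covL (A : LinConn p n) (Y : Jet p n → Jet p n) (z : Jet p n) :
    Jet p n →L[ℝ] Jet p n :=
  fderiv ℝ Y z + (A z).flip (Y z)

theorem covL_apply (A : LinConn p n) (X Y : Jet p n → Jet p n) (z : Jet p n) :
    covL A Y z (X z) = cov A X Y z := rfl

namespace LocalData

variable (S : LocalData p n)

/-- The value of a linear map in terms of its values on the adapted frame. -/
theorem map_eq_sum_frame {F : Type*} [AddCommGroup F] [Module ℝ F] (l : Jet p n →ₗ[ℝ] F)
    (z u : Jet p n) :
    l u = ∑ γ, S.dt γ u • l (S.δT γ z) + ∑ j, S.dx j u • l (S.δX j z)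
      + ∑ j, ∑ γ, S.dv j γ z u • l (S.δV j γ z) := by
  conv_lhs => rw [← S.projT_add_projX_add_projV z u]
  simp [projT, projX, projV]

/-- The connection form of the temporal part. -/
noncomputable def formT (z u : Jet p n) (α η : Fin p) : ℝ := ∑ γ, S.H α η γ z.1 * S.dt γ u

/-- The connection form with coefficients `G`, `L`, `C` of the spatial part. -/
noncomputable def formX (G : Fin n → Fin n → Fin p → Jet p n → ℝ)
    (L : Fin n → Fin n → Fin n → Jet p n → ℝ) (C : Fin n → Fin p → Fin n → Fin n → Jet p n → ℝ)
    (z u : Jet p n) (l i : Fin n) : ℝ :=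
  ∑ γ, G l i γ z * S.dt γ u + ∑ j, L l i j z * S.dx j u
    + ∑ j, ∑ γ, C l γ i j z * S.dv j γ z u

/-- The connection `A` preserves the three distributions; its connection form is `formT` on the
first one, `formX` on the second one, and is determined by these two on the third one. -/
structure Adapted (A : LinConn p n) (G : Fin n → Fin n → Fin p → Jet p n → ℝ)
    (L : Fin n → Fin n → Fin n → Jet p n → ℝ)
    (C : Fin n → Fin p → Fin n → Fin n → Jet p n → ℝ) : Prop where
  cov_δT : ∀ X, ∀ z ∈ S.dom, ∀ η,
    cov A X (S.δT η) z = ∑ α, S.formT z (X z) α η • S.δT α z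
  cov_δX : ∀ X, ∀ z ∈ S.dom, ∀ i,
    cov A X (S.δX i) z = ∑ l, S.formX G L C z (X z) l i • S.δX l z
  cov_δV : ∀ X, ∀ z ∈ S.dom, ∀ i α,
    cov A X (S.δV i α) z = ∑ l, ∑ η, (kron α η * S.formX G L C z (X z) l i
      - kron l i * S.formT z (X z) α η) • S.δV l η z

/-- The canonical coefficients `G^k_{jγ}`. -/
noncomputable def canG (k j : Fin n) (γ : Fin p) (z : Jet p n) : ℝ :=
  ∑ i, S.gInv k i z / 2 * along (S.δT γ) (S.g i j) z

/-- The canonical coefficients `L^l_{ij}`. -/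
noncomputable def canL (l i j : Fin n) (z : Jet p n) : ℝ :=
  christoffel (fun a b => S.g a b z) (fun k a b => along (S.δX k) (S.g a b) z) l i j

/-- The canonical coefficients `C^{l(γ)}_{i(j)}`. -/
noncomputable def canC (l : Fin n) (γ : Fin p) (i j : Fin n) (z : Jet p n) : ℝ :=
  christoffel (fun a b => S.g a b z) (fun k a b => along (S.δV k γ) (S.g a b) z) l i j

variable {S}

/-- The metric `h` is parallel for its own Christoffel symbols. As `h` depends on `t` alone, only
the `dt`-components of `X` contribute, so this holds along every direction of the jet space. -/
theorem Regular.along_h (hS : S.Regular) (X : Jet p n → Jet p n) (α β : Fin p) {z : Jet p n}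
    (hz : z ∈ S.dom) : along X (fun w => S.h α β w.1) z
      = ∑ μ, (S.formT z (X z) μ α * S.h μ β z.1 + S.formT z (X z) μ β * S.h α μ z.1) := by
  have hd : DifferentiableAt ℝ (S.h α β) z.1 :=
    ((hS.h_smooth α β).contDiffAt (hS.isOpen_U.mem_nhds hz.1)).differentiableAt (by simp)
  have h1 : along X (fun w => S.h α β w.1) z = fderiv ℝ (S.h α β) z.1 (X z).1 := by
    have := (hd.hasFDerivAt.comp z hasFDerivAt_fst).fderiv
    rw [along, show (fun w : Jet p n => S.h α β w.1) = S.h α β ∘ Prod.fst from rfl, this]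
    rfl
  have h2 : fderiv ℝ (S.h α β) z.1 (X z).1 = ∑ γ, pd γ (S.h α β) z.1 * S.dt γ (X z) := by
    conv_lhs => rw [pi_eq_sum_univ' (X z).1]
    rw [map_sum]
    refine Finset.sum_congr rfl fun γ _ => ?_
    rw [map_smul, smul_eq_mul, mul_comm]
    rfl
  have h3 : ∀ γ, pd γ (S.h α β) z.1 = ∑ μ, (S.H μ α γ z.1 * S.h μ β z.1
      + S.H μ β γ z.1 * S.h α μ z.1) := fun γ =>
    (christoffel_metric (g := fun a b => S.h a b z.1) (D := fun c a b => pd c (S.h a b) z.1)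
      (hS.h_symm _) (hS.h_det _ hz.1)
      (fun k i j => by rw [show S.h i j = S.h j i from funext fun t => hS.h_symm t i j]) α β γ).symm
  rw [h1, h2]
  simp only [h3, formT, Finset.sum_mul]
  rw [Finset.sum_comm]
  refine Finset.sum_congr rfl fun μ _ => ?_
  rw [← Finset.sum_add_distrib]
  refine Finset.sum_congr rfl fun γ _ => ?_
  ring

theorem IsGammaLinear.cov_δT {A : LinConn p n} (hA : S.IsGammaLinear A) (hS : S.Regular)
    (X : Jet p n → Jet p n) {z : Jet p n} (hz : z ∈ S.dom) (η : Fin p) :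
    cov A X (S.δT η) z = ∑ α, S.dt α (cov A X (S.δT η) z) • S.δT α z := by
  -- Parallelism is postulated for smooth fields only. Since `∇_X` at `z` depends only on `X z`, an
  -- arbitrary `X` may be replaced by a constant field.
  have h := hA.parallelT (fun _ => X z) (S.δT η) contDiffOn_const (hS.smooth_δT η) z hz
  rw [show (fun w => S.projT w (S.δT η w)) = S.δT η from funext fun w => by simp] at h
  exact h

theorem IsGammaLinear.cov_δX {A : LinConn p n} (hA : S.IsGammaLinear A) (hS : S.Regular)
    (X : Jet p n → Jet p n) {z : Jet p n} (hz : z ∈ S.dom) (i : Fin n) :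
    cov A X (S.δX i) z = ∑ l, S.dx l (cov A X (S.δX i) z) • S.δX l z := by
  have h := hA.parallelX (fun _ => X z) (S.δX i) contDiffOn_const (hS.smooth_δX i) z hz
  rw [show (fun w => S.projX w (S.δX i w)) = S.δX i from funext fun w => by simp] at h
  exact h

/-- `∇_X` at a point is linear in `X z`, so expanding `X z` in the frame reduces the claim to the
three prescribed families of coefficients. -/
theorem IsHNormal.dt_cov_δT {A : LinConn p n} (hA : S.IsHNormal A)
    (X : Jet p n → Jet p n) {z : Jet p n} (hz : z ∈ S.dom) (α η : Fin p) :
    S.dt α (cov A X (S.δT η) z) = S.formT z (X z) α η := by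
  have := S.map_eq_sum_frame ((dtL α).comp (covL A (S.δT η) z)).toLinearMap z (X z)
  simp only [ContinuousLinearMap.coe_coe, ContinuousLinearMap.comp_apply, covL_apply,
    dtL_apply S] at this
  rw [this, formT]
  simp only [show ∀ γ, S.dt α (cov A (S.δT γ) (S.δT η) z) = S.H α η γ z.1 from
      fun γ => hA.Gbar_eq α η γ z hz,
    show ∀ j, S.dt α (cov A (S.δX j) (S.δT η) z) = 0 from fun j => hA.Lbar_eq α η j z hz,
    show ∀ j γ, S.dt α (cov A (S.δV j γ) (S.δT η) z) = 0 from fun j γ => hA.Cbar_eq α γ η j z hz]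
  simp [mul_comm]

theorem dx_cov_δX (A : LinConn p n) (X : Jet p n → Jet p n) (z : Jet p n) (l i : Fin n) :
    S.dx l (cov A X (S.δX i) z) = S.formX (S.cG A) (S.cL A) (S.cC A) z (X z) l i := by
  have := S.map_eq_sum_frame ((dxL l).comp (covL A (S.δX i) z)).toLinearMap z (X z)
  simp only [ContinuousLinearMap.coe_coe, ContinuousLinearMap.comp_apply, covL_apply,
    dxL_apply S] at this
  rw [this, formX]
  simp only [cG, cL, cC, smul_eq_mul, mul_comm]

theorem normJ_frame (z : Jet p n) (a : Fin p → ℝ) (b : Fin n → ℝ) :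
    S.normJ z (∑ μ, a μ • S.δT μ z) (∑ l, b l • S.δX l z)
      = ∑ i, ∑ α, ((∑ β, S.h α β z.1 * a β) * b i) • S.δV i α z := by
  have h1 : ∀ β, S.dt β (∑ μ, a μ • S.δT μ z) = a β := fun β => by
    rw [← dtL_apply, map_sum]; simp only [map_smul]; simp [dtL_apply S]
  have h2 : ∀ i, S.dx i (∑ l, b l • S.δX l z) = b i := fun i => by
    rw [← dxL_apply, map_sum]; simp only [map_smul]; simp [dxL_apply S]
  simp only [normJ, h1, h2]

theorem δT_eq_sum (β : Fin p) (z : Jet p n) : S.δT β z = ∑ μ, kron μ β • S.δT μ z := by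
  simp

theorem δX_eq_sum (i : Fin n) (z : Jet p n) : S.δX i z = ∑ l, kron l i • S.δX l z := by
  simp

/-- Apply `∇J = 0` to the pair `δ/δt^β`, `δ/δx^i`, where `J` takes the value `∑ h_{αβ} ∂/∂x^i_α`. By
the parallelism of `h`, one half of the derivative of `h_{αβ}` cancels the term from `∇ δ/δt^β`; the
other half survives with a minus sign, as for a dual index. -/
theorem IsHNormal.cov_δV {A : LinConn p n} (hA : S.IsHNormal A) (hS : S.Regular)
    (X : Jet p n → Jet p n) {z : Jet p n} (hz : z ∈ S.dom) (i : Fin n) (α : Fin p) :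
    cov A X (S.δV i α) z = ∑ l, ∑ η, (kron α η * S.formX (S.cG A) (S.cL A) (S.cC A) z (X z) l i
      - kron l i * S.formT z (X z) α η) • S.δV l η z := by
  set F := S.formX (S.cG A) (S.cL A) (S.cC A) z (X z) with hF
  set T := S.formT z (X z) with hT
  -- The asserted formula contracted with `h_{αβ}`; this is all that `J` gives directly, and `h` is
  -- inverted at the end.
  have key : ∀ β, ∑ α, S.h α β z.1 • cov A X (S.δV i α) z = ∑ α, S.h α β z.1 • ∑ l, ∑ η,
      (kron α η * F l i - kron l i * T α η) • S.δV l η z := by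
    intro β
    have h := hA.parallelJ (fun _ => X z) (S.δT β) (S.δX i) contDiffOn_const (hS.smooth_δT β)
      (hS.smooth_δX i) z hz
    have hl : (fun w => S.normJ w (S.δT β w) (S.δX i w))
        = fun w => ∑ α, S.h α β w.1 • S.δV i α w := by
      funext w
      rw [δT_eq_sum, δX_eq_sum, normJ_frame]
      simp only [← Finset.sum_comm (γ := Fin p), mul_comm _ (kron _ _), mul_smul]
      simp
    rw [hl, cov_sum_smul A
      (fun α => hS.differentiableAt (Regular.contDiffOn_comp_fst (hS.h_smooth α β)) hz)
      (fun α => hS.differentiableAt (Regular.smooth_δV i α) hz),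
      hA.toIsGammaLinear.cov_δT hS _ hz, hA.toIsGammaLinear.cov_δX hS _ hz] at h
    simp only [hA.dt_cov_δT _ hz, dx_cov_δX, ← hF, ← hT, hS.along_h _ _ _ hz] at h
    rw [δX_eq_sum i z, normJ_frame] at h
    nth_rewrite 1 [δT_eq_sum β z] at h
    rw [normJ_frame] at h
    simp only [sum_mul_kron', Finset.sum_add_distrib] at h
    have h1 : ∀ c : Fin p → ℝ, ∑ x, c x • S.δV i x z
        = ∑ l, ∑ x, (kron l i * c x) • S.δV l x z := by
      intro c
      rw [Finset.sum_comm]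
      simp only [mul_smul, sum_kron_smul']
    rw [h1] at h
    rw [show ∑ α, S.h α β z.1 • cov A X (S.δV i α) z = _ from eq_sub_of_add_eq' h]
    have h3 : ∑ x, S.h x β z.1 • ∑ l, ∑ η, (kron x η * F l i - kron l i * T x η) • S.δV l η z
        = ∑ l, ∑ η, (∑ x, S.h x β z.1 * (kron x η * F l i - kron l i * T x η)) • S.δV l η z := by
      simp only [Finset.smul_sum, smul_smul, Finset.sum_smul]
      rw [Finset.sum_comm]
      exact Finset.sum_congr rfl fun l _ => Finset.sum_comm
    rw [h3]
    simp only [← Finset.sum_add_distrib, ← Finset.sum_sub_distrib, ← add_smul, ← sub_smul]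
    refine Finset.sum_congr rfl fun l _ => Finset.sum_congr rfl fun η _ => ?_
    congr 1
    have h2 : ∑ x, S.h x β z.1 * (kron x η * F l i - kron l i * T x η)
        = S.h η β z.1 * F l i - kron l i * ∑ x, T x η * S.h x β z.1 := by
      rw [Finset.mul_sum]
      simp only [mul_sub, Finset.sum_sub_distrib, ← mul_assoc, ← Finset.sum_mul, sum_mul_kron']
      congr 1
      exact Finset.sum_congr rfl fun _ _ => by ring
    rw [h2]
    simp only [mul_comm (T _ β), Finset.sum_add_distrib]
    ring
  -- Nondegeneracy of `h` recovers a family of vectors from its contractions with `h`.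
  have : ∀ f : Fin p → Jet p n, f α
      = ∑ β, S.hInv β α z.1 • ∑ μ, S.h μ β z.1 • f μ := by
    intro f
    simp only [Finset.smul_sum]
    rw [Finset.sum_comm]
    simp only [smul_smul, ← Finset.sum_smul, mul_comm (S.hInv _ _ _)]
    have := fun μ => mul_matrix_inv_apply (hS.h_det _ hz.1) μ α
    simp only [hInv, this, sum_kron_smul']
  rw [this fun α => cov A X (S.δV i α) z]
  simp only [key]
  rw [← this]

end LocalData

namespace LocalData

variable {S : LocalData p n} {A : LinConn p n}
  {G : Fin n → Fin n → Fin p → Jet p n → ℝ} {L : Fin n → Fin n → Fin n → Jet p n → ℝ}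
  {C : Fin n → Fin p → Fin n → Fin n → Jet p n → ℝ}

/-! ### The Cartan connection is adapted, with canonical coefficients -/

theorem IsHNormal.adapted (hA : S.IsHNormal A) (hS : S.Regular) :
    S.Adapted A (S.cG A) (S.cL A) (S.cC A) where
  cov_δT X z hz η := by
    rw [hA.toIsGammaLinear.cov_δT hS X hz]
    simp only [hA.dt_cov_δT X hz]
  cov_δX X z hz i := by
    rw [hA.toIsGammaLinear.cov_δX hS X hz]
    simp only [dx_cov_δX]
  cov_δV X z hz i α := hA.cov_δV hS X hz i α

theorem IsCartan.cL_eq (hA : S.IsCartan A) (hS : S.Regular) {z : Jet p n} (hz : z ∈ S.dom)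
    (l i j : Fin n) : S.cL A l i j z = S.canL l i j z :=
  eq_christoffel (Γ := fun l i j => S.cL A l i j z) (hS.g_symm z) (hS.g_det z hz)
    (fun l i j => hA.L_symm l i j z hz) (fun i j k => sub_eq_zero.1 (hA.metricX i j k z hz)) l i j

theorem IsCartan.cC_eq (hA : S.IsCartan A) (hS : S.Regular) {z : Jet p n} (hz : z ∈ S.dom)
    (l : Fin n) (γ : Fin p) (i j : Fin n) : S.cC A l γ i j z = S.canC l γ i j z :=
  eq_christoffel (Γ := fun l i j => S.cC A l γ i j z) (hS.g_symm z) (hS.g_det z hz)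
    (fun l i j => hA.C_symm l γ i j z hz)
    (fun i j k => sub_eq_zero.1 (hA.metricV i j k γ z hz)) l i j

theorem formX_congr {G' : Fin n → Fin n → Fin p → Jet p n → ℝ}
    {L' : Fin n → Fin n → Fin n → Jet p n → ℝ} {C' : Fin n → Fin p → Fin n → Fin n → Jet p n → ℝ}
    {z : Jet p n} (hG : ∀ l i γ, G l i γ z = G' l i γ z) (hL : ∀ l i j, L l i j z = L' l i j z)
    (hC : ∀ l γ i j, C l γ i j z = C' l γ i j z) (u : Jet p n) (l i : Fin n) :
    S.formX G L C z u l i = S.formX G' L' C' z u l i := by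
  simp only [formX, hG, hL, hC]

theorem Adapted.congr {G' : Fin n → Fin n → Fin p → Jet p n → ℝ}
    {L' : Fin n → Fin n → Fin n → Jet p n → ℝ} {C' : Fin n → Fin p → Fin n → Fin n → Jet p n → ℝ}
    (h : S.Adapted A G L C) (hG : ∀ l i γ, ∀ z ∈ S.dom, G l i γ z = G' l i γ z)
    (hL : ∀ l i j, ∀ z ∈ S.dom, L l i j z = L' l i j z)
    (hC : ∀ l γ i j, ∀ z ∈ S.dom, C l γ i j z = C' l γ i j z) : S.Adapted A G' L' C' where
  cov_δT := h.cov_δT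
  cov_δX X z hz i := by
    rw [h.cov_δX X z hz]
    simp only [formX_congr (hG · · · z hz) (hL · · · z hz) (hC · · · · z hz)]
  cov_δV X z hz i α := by
    rw [h.cov_δV X z hz]
    simp only [formX_congr (hG · · · z hz) (hL · · · z hz) (hC · · · · z hz)]

theorem IsCartan.adapted (hA : S.IsCartan A) (hS : S.Regular) :
    S.Adapted A S.canG S.canL S.canC :=
  (hA.toIsHNormal.adapted hS).congr (fun l i γ z hz => hA.G_eq l i γ z hz)
    (fun l i j _ hz => hA.cL_eq hS hz l i j) (fun l γ i j _ hz => hA.cC_eq hS hz l γ i j)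

/-- An adapted connection is determined by its coefficients. -/
theorem Adapted.eqOn {A' : LinConn p n} (h : S.Adapted A G L C) (h' : S.Adapted A' G L C) :
    Set.EqOn A' A S.dom := by
  intro z hz
  -- The derivative of `Y` is the same for both connections, so equal covariant derivatives give
  -- equal Christoffel maps on the value of `Y`. The frame spans, hence the maps coincide.
  have key : ∀ (Y : Jet p n → Jet p n), (∀ X, cov A' X Y z = cov A X Y z) →
      ∀ u, A' z u (Y z) = A z u (Y z) := by
    intro Y hY u
    simpa [cov] using hY fun _ => u
  refine ContinuousLinearMap.ext fun u => ContinuousLinearMap.ext fun w => ?_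
  have e1 := S.map_eq_sum_frame (A' z u).toLinearMap z w
  have e2 := S.map_eq_sum_frame (A z u).toLinearMap z w
  simp only [ContinuousLinearMap.coe_coe] at e1 e2
  rw [e1, e2]
  simp only [key _ fun X => (h'.cov_δT X z hz _).trans (h.cov_δT X z hz _).symm,
    key _ fun X => (h'.cov_δX X z hz _).trans (h.cov_δX X z hz _).symm,
    key _ fun X => (h'.cov_δV X z hz _ _).trans (h.cov_δV X z hz _ _).symm]

/-! ### Existence of adapted connections -/

/-- The temporal connection form as a linear map. -/
noncomputable def formTL (S : LocalData p n) (α η : Fin p) (z : Jet p n) : Jet p n →L[ℝ] ℝ :=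
  ∑ γ, S.H α η γ z.1 • dtL γ

theorem formTL_apply (α η : Fin p) (z u : Jet p n) : S.formTL α η z u = S.formT z u α η := by
  simp [formTL, formT, dtL_apply S]

/-- The spatial connection form as a linear map. -/
noncomputable def formXL (S : LocalData p n) (G : Fin n → Fin n → Fin p → Jet p n → ℝ)
    (L : Fin n → Fin n → Fin n → Jet p n → ℝ) (C : Fin n → Fin p → Fin n → Fin n → Jet p n → ℝ)
    (l i : Fin n) (z : Jet p n) : Jet p n →L[ℝ] ℝ :=
  ∑ γ, G l i γ z • dtL γ + ∑ j, L l i j z • dxL j + ∑ j, ∑ γ, C l γ i j z • S.dvL j γ z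

theorem formXL_apply (l i : Fin n) (z u : Jet p n) :
    S.formXL G L C l i z u = S.formX G L C z u l i := by
  simp [formXL, formX, dtL_apply S, dxL_apply S, dvL_apply]

/-- The bilinear map `(u, w) ↦ θ(w) B(u)`. -/
noncomputable def tens (θ : Jet p n →L[ℝ] ℝ) (B : Jet p n →L[ℝ] Jet p n) :
    Jet p n →L[ℝ] Jet p n →L[ℝ] Jet p n :=
  (θ.smulRight B).flip

@[simp] theorem tens_apply (θ : Jet p n →L[ℝ] ℝ) (B : Jet p n →L[ℝ] Jet p n) (u w : Jet p n) :
    tens θ B u w = θ w • B u := rfl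

section

variable {X E F : Type*} [NormedAddCommGroup X] [NormedSpace ℝ X] [NormedAddCommGroup E]
  [NormedSpace ℝ E] [NormedAddCommGroup F] [NormedSpace ℝ F] {s : Set X}

theorem contDiffOn_flip_smulRight {θ : X → E →L[ℝ] ℝ} {B : X → F →L[ℝ] F}
    (hθ : ContDiffOn ℝ ∞ θ s) (hB : ContDiffOn ℝ ∞ B s) :
    ContDiffOn ℝ ∞ (fun z => ((θ z).smulRight (B z)).flip) s :=
  have h : ContDiff ℝ ∞ (ContinuousLinearMap.flipₗᵢ ℝ E F F) :=
    LinearIsometryEquiv.contDiff (𝕜 := ℝ) (E := E →L[ℝ] F →L[ℝ] F) (F := F →L[ℝ] E →L[ℝ] F) _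
  h.comp_contDiffOn (hθ.smulRight hB)

theorem contDiffOn_sum_smulRight {ι : Type*} [Fintype ι] {φ : ι → X → E →L[ℝ] ℝ} {v : ι → X → F}
    (hφ : ∀ i, ContDiffOn ℝ ∞ (φ i) s) (hv : ∀ i, ContDiffOn ℝ ∞ (v i) s) :
    ContDiffOn ℝ ∞ (fun z => ∑ i, (φ i z).smulRight (v i z)) s :=
  ContDiffOn.sum fun i _ => (hφ i).smulRight (hv i)

end

theorem contDiffOn_tens {θ : Jet p n → Jet p n →L[ℝ] ℝ} {B : Jet p n → Jet p n →L[ℝ] Jet p n}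
    {s : Set (Jet p n)} (hθ : ContDiffOn ℝ ∞ θ s) (hB : ContDiffOn ℝ ∞ B s) :
    ContDiffOn ℝ ∞ (fun z => tens (θ z) (B z)) s :=
  contDiffOn_flip_smulRight hθ hB

/-- The adapted connection with given coefficients. -/
noncomputable def adaptedConn (S : LocalData p n) (G : Fin n → Fin n → Fin p → Jet p n → ℝ)
    (L : Fin n → Fin n → Fin n → Jet p n → ℝ) (C : Fin n → Fin p → Fin n → Fin n → Jet p n → ℝ) :
    LinConn p n := fun z =>
  -- Since `∇_X e = De(X) + A(X, e)`, the map must send `e` to its prescribed covariant derivative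
  -- minus `De`. The vertical frame is constant and needs no correction.
  ∑ η, tens (dtL η) (∑ α, (S.formTL α η z).smulRight (S.δT α z) - fderiv ℝ (S.δT η) z)
    + ∑ i, tens (dxL i) (∑ l, (S.formXL G L C l i z).smulRight (S.δX l z) - fderiv ℝ (S.δX i) z)
    + ∑ i, ∑ α, tens (S.dvL i α z) (∑ l, ∑ η, (kron α η • S.formXL G L C l i z
        - kron l i • S.formTL α η z).smulRight (S.δV l η z))

theorem adapted_adaptedConn : S.Adapted (S.adaptedConn G L C) G L C where
  cov_δT X z hz η := by
    simp [cov, adaptedConn, dtL_apply S, dxL_apply S, dvL_apply, formTL_apply]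
  cov_δX X z hz i := by
    simp [cov, adaptedConn, dtL_apply S, dxL_apply S, dvL_apply, formXL_apply]
  cov_δV X z hz i α := by
    have : fderiv ℝ (S.δV i α) z = 0 := by
      rw [show S.δV i α = fun _ => eV i α from rfl]; simp
    simp [cov, adaptedConn, dtL_apply S, dxL_apply S, dvL_apply, formXL_apply, formTL_apply, this,
      mul_smul, ← Finset.smul_sum]

namespace Regular

variable (hS : S.Regular)
include hS

theorem contDiffOn_dvL (i : Fin n) (α : Fin p) : ContDiffOn ℝ ∞ (S.dvL i α) S.dom :=
  (contDiffOn_const.add (ContDiffOn.sum fun _ _ => (hS.contDiffOn_M _ _ _).smul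
    contDiffOn_const)).add (ContDiffOn.sum fun _ _ => (hS.contDiffOn_N _ _ _).smul contDiffOn_const)

theorem contDiffOn_formTL (α η : Fin p) : ContDiffOn ℝ ∞ (S.formTL α η) S.dom :=
  ContDiffOn.sum fun _ _ => (contDiffOn_comp_fst (hS.contDiffOn_H _ _ _)).smul contDiffOn_const

theorem contDiffOn_formXL (hG : ∀ l i γ, ContDiffOn ℝ ∞ (G l i γ) S.dom)
    (hL : ∀ l i j, ContDiffOn ℝ ∞ (L l i j) S.dom)
    (hC : ∀ l γ i j, ContDiffOn ℝ ∞ (C l γ i j) S.dom) (l i : Fin n) :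
    ContDiffOn ℝ ∞ (S.formXL G L C l i) S.dom :=
  ((ContDiffOn.sum fun _ _ => (hG _ _ _).smul contDiffOn_const).add
    (ContDiffOn.sum fun _ _ => (hL _ _ _).smul contDiffOn_const)).add
    (ContDiffOn.sum fun _ _ => ContDiffOn.sum fun _ _ => (hC _ _ _ _).smul (hS.contDiffOn_dvL _ _))

theorem contDiffOn_adaptedConn (hG : ∀ l i γ, ContDiffOn ℝ ∞ (G l i γ) S.dom)
    (hL : ∀ l i j, ContDiffOn ℝ ∞ (L l i j) S.dom)
    (hC : ∀ l γ i j, ContDiffOn ℝ ∞ (C l γ i j) S.dom) :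
    ContDiffOn ℝ ∞ (S.adaptedConn G L C) S.dom := by
  refine ((ContDiffOn.sum fun η _ => ?_).add (ContDiffOn.sum fun i _ => ?_)).add
    (ContDiffOn.sum fun i _ => ContDiffOn.sum fun α _ => ?_)
  · exact contDiffOn_tens contDiffOn_const ((contDiffOn_sum_smulRight
      (fun α => hS.contDiffOn_formTL α η) fun α => hS.smooth_δT α).sub
      (hS.contDiffOn_fderiv (hS.smooth_δT _)))
  · exact contDiffOn_tens contDiffOn_const ((contDiffOn_sum_smulRight
      (fun l => hS.contDiffOn_formXL hG hL hC l i) fun l => hS.smooth_δX l).sub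
      (hS.contDiffOn_fderiv (hS.smooth_δX _)))
  · exact contDiffOn_tens (hS.contDiffOn_dvL _ _) (ContDiffOn.sum fun l _ =>
      contDiffOn_sum_smulRight (fun η => ((hS.contDiffOn_formXL hG hL hC l i).const_smul
        (kron α η)).sub ((hS.contDiffOn_formTL α η).const_smul (kron l i))) fun η => smooth_δV l η)

theorem contDiffOn_christoffel {D : Fin n → Fin n → Fin n → Jet p n → ℝ}
    (hD : ∀ k i j, ContDiffOn ℝ ∞ (D k i j) S.dom) (l i j : Fin n) :
    ContDiffOn ℝ ∞ (fun z => christoffel (fun a b => S.g a b z) (fun k a b => D k a b z) l i j)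
      S.dom :=
  ContDiffOn.sum fun _ _ => ((hS.contDiffOn_gInv _ _).div_const _).mul
    (((hD _ _ _).add (hD _ _ _)).sub (hD _ _ _))

theorem contDiffOn_canG (l i : Fin n) (γ : Fin p) : ContDiffOn ℝ ∞ (S.canG l i γ) S.dom :=
  ContDiffOn.sum fun _ _ => ((hS.contDiffOn_gInv _ _).div_const _).mul
    (hS.contDiffOn_along (hS.smooth_δT _) (hS.g_smooth _ _))

theorem contDiffOn_canL (l i j : Fin n) : ContDiffOn ℝ ∞ (S.canL l i j) S.dom :=
  hS.contDiffOn_christoffel (fun _ _ _ => hS.contDiffOn_along (hS.smooth_δX _) (hS.g_smooth _ _))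
    _ _ _

theorem contDiffOn_canC (l : Fin n) (γ : Fin p) (i j : Fin n) :
    ContDiffOn ℝ ∞ (S.canC l γ i j) S.dom :=
  hS.contDiffOn_christoffel (fun _ _ _ => hS.contDiffOn_along (smooth_δV _ _) (hS.g_smooth _ _))
    _ _ _

end Regular

end LocalData

/-! ### Verification of the axioms for adapted connections -/

theorem along_sum_mul {κ : Type*} [Fintype κ] {f g : κ → Jet p n → ℝ} {k : Jet p n → ℝ}
    {X : Jet p n → Jet p n} {z : Jet p n}
    (hf : ∀ β, DifferentiableAt ℝ (f β) z) (hg : ∀ β, DifferentiableAt ℝ (g β) z)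
    (hk : DifferentiableAt ℝ k z) :
    along X (fun w => (∑ β, f β w * g β w) * k w) z
      = (∑ β, (along X (f β) z * g β z + f β z * along X (g β) z)) * k z
        + (∑ β, f β z * g β z) * along X k z := by
  have hs : DifferentiableAt ℝ (fun w => ∑ β, f β w * g β w) z :=
    DifferentiableAt.fun_sum fun β _ => (hf β).fun_mul (hg β)
  simp only [along]
  rw [fderiv_fun_mul hs hk, fderiv_fun_sum fun β _ => (hf β).fun_mul (hg β)]
  simp only [add_apply, smul_apply, sum_apply, smul_eq_mul, fderiv_fun_mul (hf _) (hg _)]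
  rw [add_comm, mul_comm (k z)]
  congr 2
  exact Finset.sum_congr rfl fun β _ => by ring

theorem sum_sum_comm_sum_sum {ι κ ι' κ' E : Type*} [Fintype ι] [Fintype κ] [Fintype ι'] [Fintype κ']
    [AddCommMonoid E] (g : ι → κ → ι' → κ' → E) :
    ∑ i, ∑ a, ∑ l, ∑ b, g i a l b = ∑ l, ∑ b, ∑ i, ∑ a, g i a l b := by
  rw [Finset.sum_congr rfl fun i _ => Finset.sum_comm, Finset.sum_comm]
  refine Finset.sum_congr rfl fun l _ => ?_
  rw [Finset.sum_congr rfl fun i _ => Finset.sum_comm, Finset.sum_comm]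

namespace LocalData

/-- The tangent vector with components `a`, `b`, `c` in the adapted frame. -/
noncomputable def frameSum (S : LocalData p n) (z : Jet p n) (a : Fin p → ℝ) (b : Fin n → ℝ)
    (c : Fin n → Fin p → ℝ) : Jet p n :=
  ∑ α, a α • S.δT α z + ∑ i, b i • S.δX i z + ∑ i, ∑ α, c i α • S.δV i α z

variable {S : LocalData p n}

@[simp] theorem dt_frameSum (z : Jet p n) (a : Fin p → ℝ) (b : Fin n → ℝ) (c : Fin n → Fin p → ℝ)
    (α : Fin p) : S.dt α (S.frameSum z a b c) = a α := by
  rw [← dtL_apply, frameSum]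
  simp only [map_add, map_sum, map_smul]
  simp [dtL_apply S]

@[simp] theorem dx_frameSum (z : Jet p n) (a : Fin p → ℝ) (b : Fin n → ℝ) (c : Fin n → Fin p → ℝ)
    (i : Fin n) : S.dx i (S.frameSum z a b c) = b i := by
  rw [← dxL_apply, frameSum]
  simp only [map_add, map_sum, map_smul]
  simp [dxL_apply S]

@[simp] theorem dv_frameSum (z : Jet p n) (a : Fin p → ℝ) (b : Fin n → ℝ) (c : Fin n → Fin p → ℝ)
    (i : Fin n) (α : Fin p) : S.dv i α z (S.frameSum z a b c) = c i α := by
  rw [← dvL_apply, frameSum]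
  simp only [map_add, map_sum, map_smul]
  simp [dvL_apply, mul_left_comm (c _ _)]
  simp only [← Finset.mul_sum, sum_mul_kron, sum_kron_mul]

theorem projT_frameSum (z : Jet p n) (a : Fin p → ℝ) (b : Fin n → ℝ) (c : Fin n → Fin p → ℝ) :
    S.projT z (S.frameSum z a b c) = ∑ α, a α • S.δT α z := by
  simp [projT]

theorem projX_frameSum (z : Jet p n) (a : Fin p → ℝ) (b : Fin n → ℝ) (c : Fin n → Fin p → ℝ) :
    S.projX z (S.frameSum z a b c) = ∑ i, b i • S.δX i z := by
  simp [projX]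

theorem projV_frameSum (z : Jet p n) (a : Fin p → ℝ) (b : Fin n → ℝ) (c : Fin n → Fin p → ℝ) :
    S.projV z (S.frameSum z a b c) = ∑ i, ∑ α, c i α • S.δV i α z := by
  simp [projV]

namespace Regular

variable (hS : S.Regular) {Y : Jet p n → Jet p n} (hY : S.SmoothField Y)
include hY

theorem contDiffOn_dt (α : Fin p) : ContDiffOn ℝ ∞ (fun w => S.dt α (Y w)) S.dom :=
  (dtL α).contDiff.comp_contDiffOn hY

theorem contDiffOn_dx (i : Fin n) : ContDiffOn ℝ ∞ (fun w => S.dx i (Y w)) S.dom :=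
  (dxL i).contDiff.comp_contDiffOn hY

include hS in
theorem contDiffOn_dv (i : Fin n) (α : Fin p) :
    ContDiffOn ℝ ∞ (fun w => S.dv i α w (Y w)) S.dom := by
  simp only [← dvL_apply]
  exact (hS.contDiffOn_dvL i α).clm_apply hY

end Regular

theorem Regular.along_g_symm (hS : S.Regular) (X : Jet p n → Jet p n) (i j : Fin n) (z : Jet p n) :
    along X (S.g i j) z = along X (S.g j i) z := by
  rw [show S.g i j = S.g j i from funext fun z => hS.g_symm z i j]

namespace Adapted

variable {A : LinConn p n}
  {G : Fin n → Fin n → Fin p → Jet p n → ℝ} {L : Fin n → Fin n → Fin n → Jet p n → ℝ}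
  {C : Fin n → Fin p → Fin n → Fin n → Jet p n → ℝ}
  (h : S.Adapted A G L C) (hS : S.Regular) (X : Jet p n → Jet p n) {z : Jet p n} (hz : z ∈ S.dom)
include h hS hz

theorem cov_sum_δT {f : Fin p → Jet p n → ℝ} (hf : ∀ α, ContDiffOn ℝ ∞ (f α) S.dom) :
    cov A X (fun w => ∑ α, f α w • S.δT α w) z
      = ∑ α, (along X (f α) z + ∑ μ, S.formT z (X z) α μ * f μ z) • S.δT α z := by
  rw [cov_sum_smul A (fun α => hS.differentiableAt (hf α) hz)
    (fun α => hS.differentiableAt (hS.smooth_δT α) hz)]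
  simp only [h.cov_δT X z hz, Finset.sum_add_distrib, add_smul, Finset.sum_smul, Finset.smul_sum,
    smul_smul]
  congr 1
  rw [Finset.sum_comm]
  simp only [mul_comm]

theorem cov_sum_δX {f : Fin n → Jet p n → ℝ} (hf : ∀ i, ContDiffOn ℝ ∞ (f i) S.dom) :
    cov A X (fun w => ∑ i, f i w • S.δX i w) z
      = ∑ i, (along X (f i) z + ∑ l, S.formX G L C z (X z) i l * f l z) • S.δX i z := by
  rw [cov_sum_smul A (fun α => hS.differentiableAt (hf α) hz)
    (fun α => hS.differentiableAt (hS.smooth_δX α) hz)]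
  simp only [h.cov_δX X z hz, Finset.sum_add_distrib, add_smul, Finset.sum_smul, Finset.smul_sum,
    smul_smul]
  congr 1
  rw [Finset.sum_comm]
  simp only [mul_comm]

theorem cov_sum_δV {f : Fin n → Fin p → Jet p n → ℝ}
    (hf : ∀ i α, ContDiffOn ℝ ∞ (f i α) S.dom) :
    cov A X (fun w => ∑ i, ∑ α, f i α w • S.δV i α w) z
      = ∑ i, ∑ α, (along X (f i α) z + ∑ l, S.formX G L C z (X z) i l * f l α z
        - ∑ η, f i η z * S.formT z (X z) η α) • S.δV i α z := by
  -- The double sum is read over the product index set, so that the Leibniz rule for a single finite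
  -- family applies.
  have e : (fun w => ∑ i, ∑ α, f i α w • S.δV i α w)
      = fun w => ∑ x : Fin n × Fin p, f x.1 x.2 w • S.δV x.1 x.2 w := by
    funext w
    rw [Fintype.sum_prod_type]
  rw [e, cov_sum_smul A (f := fun x : Fin n × Fin p => f x.1 x.2)
    (e := fun x : Fin n × Fin p => S.δV x.1 x.2) (fun x => hS.differentiableAt (hf x.1 x.2) hz)
    (fun x => hS.differentiableAt (Regular.smooth_δV x.1 x.2) hz), Fintype.sum_prod_type]
  simp only [h.cov_δV X z hz, Finset.sum_add_distrib, add_smul, add_sub_assoc]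
  congr 1
  simp only [Finset.smul_sum, smul_smul]
  rw [sum_sum_comm_sum_sum]
  simp only [← Finset.sum_smul]
  refine Finset.sum_congr rfl fun l _ => Finset.sum_congr rfl fun η _ => ?_
  congr 1
  simp only [mul_sub, Finset.sum_sub_distrib]
  congr 1
  · refine Finset.sum_congr rfl fun i _ => ?_
    simp only [mul_left_comm (f _ _ _), sum_kron_mul']
    ring
  · rw [Finset.sum_comm]
    simp only [mul_left_comm (f _ _ _), sum_kron_mul]

/-- The blocks do not mix: each group of components of `∇_X Y` involves only the same group of
components of `Y`. This is what makes the three projections parallel. -/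
theorem cov_eq {Y : Jet p n → Jet p n} (hY : S.SmoothField Y) :
    cov A X Y z = S.frameSum z
      (fun α => along X (fun w => S.dt α (Y w)) z + ∑ μ, S.formT z (X z) α μ * S.dt μ (Y z))
      (fun i => along X (fun w => S.dx i (Y w)) z
        + ∑ l, S.formX G L C z (X z) i l * S.dx l (Y z))
      (fun i α => along X (fun w => S.dv i α w (Y w)) z
        + ∑ l, S.formX G L C z (X z) i l * S.dv l α z (Y z)
        - ∑ η, S.dv i η z (Y z) * S.formT z (X z) η α) := by
  have hT := fun α => Regular.contDiffOn_dt hY α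
  have hX := fun i => Regular.contDiffOn_dx hY i
  have hV := fun i α => hS.contDiffOn_dv hY i α
  have sT : ContDiffOn ℝ ∞ (fun w => ∑ α, S.dt α (Y w) • S.δT α w) S.dom :=
    ContDiffOn.sum fun α _ => (hT α).smul (hS.smooth_δT α)
  have sX : ContDiffOn ℝ ∞ (fun w => ∑ i, S.dx i (Y w) • S.δX i w) S.dom :=
    ContDiffOn.sum fun i _ => (hX i).smul (hS.smooth_δX i)
  have sV : ContDiffOn ℝ ∞ (fun w => ∑ i, ∑ α, S.dv i α w (Y w) • S.δV i α w) S.dom :=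
    ContDiffOn.sum fun i _ => ContDiffOn.sum fun α _ => (hV i α).smul (Regular.smooth_δV i α)
  have e : Y = fun w => (∑ α, S.dt α (Y w) • S.δT α w + ∑ i, S.dx i (Y w) • S.δX i w)
      + ∑ i, ∑ α, S.dv i α w (Y w) • S.δV i α w :=
    funext fun w => (S.projT_add_projX_add_projV w (Y w)).symm
  conv_lhs => rw [e]
  rw [cov_add A ((hS.differentiableAt sT hz).fun_add (hS.differentiableAt sX hz))
    (hS.differentiableAt sV hz), cov_add A (hS.differentiableAt sT hz)
    (hS.differentiableAt sX hz), h.cov_sum_δT hS X hz hT, h.cov_sum_δX hS X hz hX,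
    h.cov_sum_δV hS X hz hV]
  rfl

omit hS

theorem cGbar_eq (α β γ : Fin p) : S.cGbar A α β γ z = S.H α β γ z.1 := by
  have := h.cov_δT (S.δT γ) z hz β
  rw [cGbar, this, ← dtL_apply]
  simp only [map_sum, map_smul]
  simp [dtL_apply S, formT]

theorem cLbar_eq (α β : Fin p) (j : Fin n) : S.cLbar A α β j z = 0 := by
  have := h.cov_δT (S.δX j) z hz β
  rw [cLbar, this, ← dtL_apply]
  simp only [map_sum, map_smul]
  simp [dtL_apply S, formT]

theorem cCbar_eq (α γ β : Fin p) (j : Fin n) : S.cCbar A α γ β j z = 0 := by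
  have := h.cov_δT (S.δV j γ) z hz β
  rw [cCbar, this, ← dtL_apply]
  simp only [map_sum, map_smul]
  simp [dtL_apply S, formT]

theorem cG_eq (l i : Fin n) (γ : Fin p) : S.cG A l i γ z = G l i γ z := by
  have := h.cov_δX (S.δT γ) z hz i
  rw [cG, this, ← dxL_apply]
  simp only [map_sum, map_smul]
  simp [dxL_apply S, formX]

theorem cL_eq (l i j : Fin n) : S.cL A l i j z = L l i j z := by
  have := h.cov_δX (S.δX j) z hz i
  rw [cL, this, ← dxL_apply]
  simp only [map_sum, map_smul]
  simp [dxL_apply S, formX]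

theorem cC_eq (l : Fin n) (γ : Fin p) (i j : Fin n) : S.cC A l γ i j z = C l γ i j z := by
  have := h.cov_δX (S.δV j γ) z hz i
  rw [cC, this, ← dxL_apply]
  simp only [map_sum, map_smul]
  simp [dxL_apply S, formX, mul_left_comm (C _ _ _ _ _)]
  simp only [← Finset.mul_sum, sum_mul_kron', sum_kron_mul']

omit hz
include hS

theorem isGammaLinear (hA : ContDiffOn ℝ ∞ A S.dom) : S.IsGammaLinear A where
  smooth := hA
  parallelT X Y hX hY z hz := by
    rw [h.cov_eq hS X hz hY, projT_frameSum,
      ← h.cov_sum_δT hS X hz fun α => Regular.contDiffOn_dt hY α]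
    rfl
  parallelX X Y hX hY z hz := by
    rw [h.cov_eq hS X hz hY, projX_frameSum,
      ← h.cov_sum_δX hS X hz fun α => Regular.contDiffOn_dx hY α]
    rfl
  parallelV X Y hX hY z hz := by
    rw [h.cov_eq hS X hz hY, projV_frameSum,
      ← h.cov_sum_δV hS X hz fun i α => hS.contDiffOn_dv hY i α]
    rfl

theorem isHNormal (hA : ContDiffOn ℝ ∞ A S.dom) : S.IsHNormal A where
  toIsGammaLinear := h.isGammaLinear hS hA
  Gbar_eq α β γ z hz := h.cGbar_eq hz α β γ
  Lbar_eq α β j z hz := h.cLbar_eq hz α β j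
  Cbar_eq α γ β j z hz := h.cCbar_eq hz α γ β j
  parallelJ W X Y hW hX hY z hz := by
    have hT := fun α => Regular.contDiffOn_dt hX α
    have hX' := fun i => Regular.contDiffOn_dx hY i
    have hh := fun α β => Regular.contDiffOn_comp_fst (n := n) (hS.h_smooth α β)
    simp only [normJ]
    rw [h.cov_sum_δV hS W hz fun i α => (ContDiffOn.sum fun β _ => (hh α β).mul (hT β)).mul (hX' i)]
    rw [h.cov_eq hS W hz hX, h.cov_eq hS W hz hY]
    simp only [dt_frameSum, dx_frameSum, ← Finset.sum_add_distrib, ← add_smul]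
    refine Finset.sum_congr rfl fun i _ => Finset.sum_congr rfl fun α _ => ?_
    congr 1
    rw [along_sum_mul (fun β => hS.differentiableAt (hh α β) hz)
      (fun β => hS.differentiableAt (hT β) hz) (hS.differentiableAt (hX' i) hz)]
    simp only [hS.along_h _ _ _ hz, add_mul, mul_add, Finset.sum_add_distrib, Finset.sum_mul,
      Finset.mul_sum]
    have e1 : ∑ x, ∑ μ, S.formT z (W z) μ α * S.h μ x z.1 * S.dt x (X z) * S.dx i (Y z)
        = ∑ μ, ∑ x, S.h μ x z.1 * S.dt x (X z) * S.dx i (Y z) * S.formT z (W z) μ α := by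
      rw [Finset.sum_comm]
      exact Finset.sum_congr rfl fun _ _ => Finset.sum_congr rfl fun _ _ => by ring
    have e2 : ∑ x, ∑ μ, S.formT z (W z) μ x * S.h α μ z.1 * S.dt x (X z) * S.dx i (Y z)
        = ∑ μ, ∑ x, S.h α μ z.1 * (S.formT z (W z) μ x * S.dt x (X z)) * S.dx i (Y z) := by
      rw [Finset.sum_comm]
      exact Finset.sum_congr rfl fun _ _ => Finset.sum_congr rfl fun _ _ => by ring
    have e3 : ∑ l, ∑ x, S.formX G L C z (W z) i l * (S.h α x z.1 * S.dt x (X z) * S.dx l (Y z))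
        = ∑ l, ∑ x, S.h α x z.1 * S.dt x (X z) * (S.formX G L C z (W z) i l * S.dx l (Y z)) := by
      exact Finset.sum_congr rfl fun _ _ => Finset.sum_congr rfl fun _ _ => by ring
    rw [e1, e2, e3]
    abel

omit h in
/-- The adapted connection with the canonical coefficients is the Cartan canonical connection. -/
theorem isCartan (h : S.Adapted A S.canG S.canL S.canC) (hA : ContDiffOn ℝ ∞ A S.dom) :
    S.IsCartan A where
  toIsHNormal := h.isHNormal hS hA
  metricX i j k z hz := by
    simp only [h.cL_eq hz]
    exact sub_eq_zero.2 (christoffel_metric (D := fun k a b => along (S.δX k) (S.g a b) z)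
      (hS.g_symm z) (hS.g_det z hz) (fun _ _ _ => hS.along_g_symm _ _ _ z) i j k).symm
  metricV i j k γ z hz := by
    simp only [h.cC_eq hz]
    exact sub_eq_zero.2 (christoffel_metric (D := fun k a b => along (S.δV k γ) (S.g a b) z)
      (hS.g_symm z) (hS.g_det z hz) (fun _ _ _ => hS.along_g_symm _ _ _ z) i j k).symm
  G_eq k j γ z hz := h.cG_eq hz k j γ
  L_symm k i j z hz := by
    rw [h.cL_eq hz, h.cL_eq hz]
    exact christoffel_symm (D := fun k a b => along (S.δX k) (S.g a b) z)
      (fun _ _ _ => hS.along_g_symm _ _ _ z) k i j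
  C_symm i γ j k z hz := by
    rw [h.cC_eq hz, h.cC_eq hz]
    exact christoffel_symm (D := fun k a b => along (S.δV k γ) (S.g a b) z)
      (fun _ _ _ => hS.along_g_symm _ _ _ z) i j k

end Adapted

end LocalData

theorem along_neg (X : Jet p n → Jet p n) (f : Jet p n → ℝ) (z : Jet p n) :
    along X (fun w => -f w) z = -along X f z := by
  simp [along, fderiv_fun_neg]

@[simp] theorem along_const (X : Jet p n → Jet p n) (c : ℝ) (z : Jet p n) :
    along X (fun _ => c) z = 0 := by
  simp [along]

theorem along_congr {X : Jet p n → Jet p n} {f g : Jet p n → ℝ} {z : Jet p n}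
    (h : f =ᶠ[nhds z] g) : along X f z = along X g z := by
  simp [along, h.fderiv_eq]

theorem along_mul_sub_mul {X : Jet p n → Jet p n} {f g : Jet p n → ℝ} {z : Jet p n} (a b : ℝ)
    (hf : DifferentiableAt ℝ f z) (hg : DifferentiableAt ℝ g z) :
    along X (fun w => a * f w - b * g w) z = a * along X f z - b * along X g z := by
  simp only [along]
  rw [fderiv_fun_sub (hf.const_mul a) (hg.const_mul b), fderiv_const_mul hf, fderiv_const_mul hg]
  rfl

namespace LocalData

variable {S : LocalData p n}

/-! ### The curvature of an adapted connection -/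

/-- The curvature form on a family of vector fields with connection forms `a`, `b`, `c` in the
directions `X`, `Y`, `[X, Y]`. -/
noncomputable def blockCurv {κ : Type*} [Fintype κ] (X Y : Jet p n → Jet p n)
    (a b : κ → κ → Jet p n → ℝ) (c : κ → κ → ℝ) (z : Jet p n) (k j : κ) : ℝ :=
  along X (b k j) z - along Y (a k j) z
    + ∑ m, (b m j z * a k m z - a m j z * b k m z) - c k j

/-- The curvature form of the temporal part. -/
noncomputable def curvT (S : LocalData p n) (X Y : Jet p n → Jet p n) (z : Jet p n) :
    Fin p → Fin p → ℝ :=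
  blockCurv X Y (fun α η w => S.formT w (X w) α η) (fun α η w => S.formT w (Y w) α η)
    (S.formT z (VectorField.lieBracket ℝ X Y z)) z

/-- The curvature form of the spatial part. -/
noncomputable def curvX (S : LocalData p n) (G : Fin n → Fin n → Fin p → Jet p n → ℝ)
    (L : Fin n → Fin n → Fin n → Jet p n → ℝ) (C : Fin n → Fin p → Fin n → Fin n → Jet p n → ℝ)
    (X Y : Jet p n → Jet p n) (z : Jet p n) : Fin n → Fin n → ℝ :=
  blockCurv X Y (fun l i w => S.formX G L C w (X w) l i) (fun l i w => S.formX G L C w (Y w) l i)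
    (S.formX G L C z (VectorField.lieBracket ℝ X Y z)) z

/-- Product of two matrices of the shape `b ⊗ 1 - 1 ⊗ t`. The two mixed terms are exchanged when the
factors are, so they drop out of the commutator. -/
theorem sum_block_mul (a b : Fin n → Fin n → ℝ) (s t : Fin p → Fin p → ℝ) (l i : Fin n)
    (η α : Fin p) :
    ∑ m, ∑ μ, (kron α μ * b m i - kron m i * t α μ) * (kron μ η * a l m - kron l m * s μ η)
      = kron α η * (∑ m, b m i * a l m) - b l i * s α η - t α η * a l i
        + kron l i * ∑ μ, t α μ * s μ η := by
  have e : ∀ m μ, (kron α μ * b m i - kron m i * t α μ) * (kron μ η * a l m - kron l m * s μ η)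
      = kron α μ * (kron μ η * (b m i * a l m)) - kron l m * (kron α μ * (b m i * s μ η))
        - kron m i * (kron μ η * (t α μ * a l m))
        + kron m i * (kron l m * (t α μ * s μ η)) := fun m μ => by ring
  simp only [e, Finset.sum_add_distrib, Finset.sum_sub_distrib, sum_kron_mul, sum_kron_mul',
    ← Finset.mul_sum]

namespace Adapted

variable {A : LinConn p n}
  {G : Fin n → Fin n → Fin p → Jet p n → ℝ} {L : Fin n → Fin n → Fin n → Jet p n → ℝ}
  {C : Fin n → Fin p → Fin n → Fin n → Jet p n → ℝ}
  (h : S.Adapted A G L C) (hS : S.Regular)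
  (hG : ∀ l i γ, ContDiffOn ℝ ∞ (G l i γ) S.dom) (hL : ∀ l i j, ContDiffOn ℝ ∞ (L l i j) S.dom)
  (hC : ∀ l γ i j, ContDiffOn ℝ ∞ (C l γ i j) S.dom)
  {X Y : Jet p n → Jet p n} (hX : S.SmoothField X) (hY : S.SmoothField Y)
  {z : Jet p n} (hz : z ∈ S.dom)
include hS hX hz

theorem differentiableAt_formT (α η : Fin p) :
    DifferentiableAt ℝ (fun w => S.formT w (X w) α η) z := by
  simp only [← formTL_apply]
  exact hS.differentiableAt ((hS.contDiffOn_formTL α η).clm_apply hX) hz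

include hG hL hC in
theorem differentiableAt_formX (l i : Fin n) :
    DifferentiableAt ℝ (fun w => S.formX G L C w (X w) l i) z := by
  simp only [← formXL_apply]
  exact hS.differentiableAt ((hS.contDiffOn_formXL hG hL hC l i).clm_apply hX) hz

include h hY

theorem curv_δT (η : Fin p) :
    curv A X Y (S.δT η) z = ∑ α, S.curvT X Y z α η • S.δT α z :=
  curv_of_block A (hS.dom_mem_nhds hz) (fun j w hw => h.cov_δT X w hw j)
    (fun j w hw => h.cov_δT Y w hw j) (fun j => h.cov_δT _ z hz j)
    (differentiableAt_formT hS hX hz) (differentiableAt_formT hS hY hz)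
    (fun α => hS.differentiableAt (hS.smooth_δT α) hz) η

include hG hL hC

theorem curv_δX (i : Fin n) :
    curv A X Y (S.δX i) z = ∑ l, S.curvX G L C X Y z l i • S.δX l z :=
  curv_of_block A (hS.dom_mem_nhds hz) (fun j w hw => h.cov_δX X w hw j)
    (fun j w hw => h.cov_δX Y w hw j) (fun j => h.cov_δX _ z hz j)
    (differentiableAt_formX hS hG hL hC hX hz) (differentiableAt_formX hS hG hL hC hY hz)
    (fun α => hS.differentiableAt (hS.smooth_δX α) hz) i

/-- The vertical distribution carries the connection of `h_M ⊗ h_T*`, so its curvature is the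
spatial one minus the transposed temporal one. -/
theorem curv_δV (i : Fin n) (α : Fin p) :
    curv A X Y (S.δV i α) z = ∑ l, ∑ η, (kron α η * S.curvX G L C X Y z l i
      - kron l i * S.curvT X Y z α η) • S.δV l η z := by
  have hcov : ∀ (X : Jet p n → Jet p n) (w) (_ : w ∈ S.dom) (j : Fin n × Fin p),
      cov A X (S.δV j.1 j.2) w = ∑ x : Fin n × Fin p, (kron j.2 x.2 * S.formX G L C w (X w) x.1 j.1
      - kron x.1 j.1 * S.formT w (X w) j.2 x.2) • S.δV x.1 x.2 w := fun X w hw j => by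
    rw [h.cov_δV X w hw, Fintype.sum_prod_type]
  have hdT := fun {X} (hX : S.SmoothField X) => differentiableAt_formT hS hX hz
  have hdX := fun {X} (hX : S.SmoothField X) => differentiableAt_formX hS hG hL hC hX hz
  have := curv_of_block A (X := X) (Y := Y) (e := fun x : Fin n × Fin p => S.δV x.1 x.2)
    (hS.dom_mem_nhds hz)
    (a := fun x j w => kron j.2 x.2 * S.formX G L C w (X w) x.1 j.1
      - kron x.1 j.1 * S.formT w (X w) j.2 x.2)
    (b := fun x j w => kron j.2 x.2 * S.formX G L C w (Y w) x.1 j.1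
      - kron x.1 j.1 * S.formT w (Y w) j.2 x.2)
    (fun j w hw => hcov X w hw j) (fun j w hw => hcov Y w hw j)
    (fun j => hcov (VectorField.lieBracket ℝ X Y) z hz j)
    (fun k j => ((hdX hX _ _).const_mul _).sub ((hdT hX _ _).const_mul _))
    (fun k j => ((hdX hY _ _).const_mul _).sub ((hdT hY _ _).const_mul _))
    (fun k => hS.differentiableAt (Regular.smooth_δV k.1 k.2) hz) (i, α)
  rw [this, Fintype.sum_prod_type]
  refine Finset.sum_congr rfl fun l _ => Finset.sum_congr rfl fun η _ => ?_
  congr 1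
  dsimp only
  rw [along_mul_sub_mul _ _ (hdX hY _ _) (hdT hY _ _),
    along_mul_sub_mul _ _ (hdX hX _ _) (hdT hX _ _), Fintype.sum_prod_type]
  simp only [Finset.sum_sub_distrib]
  rw [sum_block_mul, sum_block_mul]
  simp only [curvX, curvT, blockCurv, Finset.sum_sub_distrib]
  -- The temporal matrices are transposed in the vertical block, hence multiplied in the opposite
  -- order; commuting the scalar factors restores the form used in `curvT`.
  have e1 : ∑ m, S.formT z (Y z) m η * S.formT z (X z) α m
      = ∑ m, S.formT z (X z) α m * S.formT z (Y z) m η :=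
    Finset.sum_congr rfl fun _ _ => mul_comm _ _
  have e2 : ∑ m, S.formT z (X z) m η * S.formT z (Y z) α m
      = ∑ m, S.formT z (Y z) α m * S.formT z (X z) m η :=
    Finset.sum_congr rfl fun _ _ => mul_comm _ _
  simp only [e1, e2]
  ring

end Adapted

/-! ### Connection and curvature forms on the adapted frame -/

section Forms

variable (G : Fin n → Fin n → Fin p → Jet p n → ℝ) (L : Fin n → Fin n → Fin n → Jet p n → ℝ)
  (C : Fin n → Fin p → Fin n → Fin n → Jet p n → ℝ)

@[simp] theorem formT_δT (z : Jet p n) (α η γ : Fin p) :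
    S.formT z (S.δT γ z) α η = S.H α η γ z.1 := by
  simp [formT]

@[simp] theorem formT_δX (z : Jet p n) (α η : Fin p) (j : Fin n) :
    S.formT z (S.δX j z) α η = 0 := by
  simp [formT]

@[simp] theorem formT_δV (z : Jet p n) (α η : Fin p) (j : Fin n) (γ : Fin p) :
    S.formT z (S.δV j γ z) α η = 0 := by
  simp [formT]

@[simp] theorem formX_δT (z : Jet p n) (l i : Fin n) (γ : Fin p) :
    S.formX G L C z (S.δT γ z) l i = G l i γ z := by
  simp [formX]

@[simp] theorem formX_δX (z : Jet p n) (l i j : Fin n) :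
    S.formX G L C z (S.δX j z) l i = L l i j z := by
  simp [formX]

@[simp] theorem formX_δV (z : Jet p n) (l i j : Fin n) (γ : Fin p) :
    S.formX G L C z (S.δV j γ z) l i = C l γ i j z := by
  simp [formX, mul_left_comm (C _ _ _ _ _)]
  simp only [← Finset.mul_sum, sum_mul_kron', sum_kron_mul']

end Forms

/-- The field `X` is smooth and its components on `∂/∂t^α`, `∂/∂x^i` are constant. -/
structure ConstBase (S : LocalData p n) (X : Jet p n → Jet p n) : Prop where
  smooth : S.SmoothField X
  fst : ∀ w w', (X w).1 = (X w').1
  snd : ∀ w w', (X w).2.1 = (X w').2.1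

theorem Regular.constBase_δT (hS : S.Regular) (α : Fin p) : S.ConstBase (S.δT α) where
  smooth := hS.smooth_δT α
  fst w w' := funext fun β => (S.dt_δT β α w).trans (S.dt_δT β α w').symm
  snd w w' := funext fun i => (S.dx_δT i α w).trans (S.dx_δT i α w').symm

theorem Regular.constBase_δX (hS : S.Regular) (i : Fin n) : S.ConstBase (S.δX i) where
  smooth := hS.smooth_δX i
  fst w w' := funext fun β => (S.dt_δX β i w).trans (S.dt_δX β i w').symm
  snd w w' := funext fun j => (S.dx_δX j i w).trans (S.dx_δX j i w').symm

theorem constBase_δV (i : Fin n) (α : Fin p) : S.ConstBase (S.δV i α) where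
  smooth := Regular.smooth_δV i α
  fst _ _ := rfl
  snd _ _ := rfl

namespace ConstBase

variable {X Y : Jet p n → Jet p n} (hX : S.ConstBase X) (hY : S.ConstBase Y) (hS : S.Regular)
  {z : Jet p n} (hz : z ∈ S.dom)

theorem fderiv_comp_clm (hS : S.Regular) (hX : S.SmoothField X) (hz : z ∈ S.dom)
    (l : Jet p n →L[ℝ] ℝ) (u : Jet p n) :
    l (fderiv ℝ X z u) = fderiv ℝ (fun w => l (X w)) z u := by
  have := (l.hasFDerivAt.comp z (hS.differentiableAt hX hz).hasFDerivAt).fderiv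
  rw [show (fun w => l (X w)) = l ∘ X from rfl, this]
  rfl

include hX hS hz

theorem dt_fderiv (α : Fin p) (u : Jet p n) : S.dt α (fderiv ℝ X z u) = 0 := by
  rw [← dtL_apply, fderiv_comp_clm hS hX.smooth hz,
    show (fun w => dtL α (X w)) = fun _ => dtL α (X z) from
      funext fun w => congrFun (hX.fst w z) α]
  simp

theorem dx_fderiv (i : Fin n) (u : Jet p n) : S.dx i (fderiv ℝ X z u) = 0 := by
  rw [← dxL_apply, fderiv_comp_clm hS hX.smooth hz,
    show (fun w => dxL i (X w)) = fun _ => dxL i (X z) from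
      funext fun w => congrFun (hX.snd w z) i]
  simp

/-- The derivative of such a field is vertical, so the corrections by `M` and `N` in `dv` contribute
nothing. -/
theorem dv_fderiv (i : Fin n) (α : Fin p) (u : Jet p n) :
    S.dv i α z (fderiv ℝ X z u) = fderiv ℝ (fun w => (X w).2.2 i α) z u := by
  have h1 : ∀ β, (fderiv ℝ X z u).1 β = 0 := fun β => hX.dt_fderiv hS hz β u
  have h2 : ∀ β, (fderiv ℝ X z u).2.1 β = 0 := fun β => hX.dx_fderiv hS hz β u
  simp only [dv, h1, h2, mul_zero, Finset.sum_const_zero, add_zero]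
  exact fderiv_comp_clm hS hX.smooth hz (coordVL i α) u

include hY

theorem formT_lieBracket (α η : Fin p) :
    S.formT z (VectorField.lieBracket ℝ X Y z) α η = 0 := by
  have : ∀ γ, S.dt γ (VectorField.lieBracket ℝ X Y z) = 0 := fun γ => by
    rw [VectorField.lieBracket, ← dtL_apply, map_sub, dtL_apply S, dtL_apply S,
      hX.dt_fderiv hS hz, hY.dt_fderiv hS hz, sub_zero]
  simp [formT, this]

/-- The bracket is vertical, so only the `C` part of the form sees it. This is where the torsion
terms of the curvature formulas come from. -/
theorem formX_lieBracket (G : Fin n → Fin n → Fin p → Jet p n → ℝ)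
    (L : Fin n → Fin n → Fin n → Jet p n → ℝ) (C : Fin n → Fin p → Fin n → Fin n → Jet p n → ℝ)
    (l i : Fin n) :
    S.formX G L C z (VectorField.lieBracket ℝ X Y z) l i
      = ∑ m, ∑ μ, C l μ i m z * (along X (fun w => (Y w).2.2 m μ) z
        - along Y (fun w => (X w).2.2 m μ) z) := by
  have h1 : ∀ γ, S.dt γ (VectorField.lieBracket ℝ X Y z) = 0 := fun γ => by
    rw [VectorField.lieBracket, ← dtL_apply, map_sub, dtL_apply S, dtL_apply S,
      hX.dt_fderiv hS hz, hY.dt_fderiv hS hz, sub_zero]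
  have h2 : ∀ γ, S.dx γ (VectorField.lieBracket ℝ X Y z) = 0 := fun γ => by
    rw [VectorField.lieBracket, ← dxL_apply, map_sub, dxL_apply S, dxL_apply S,
      hX.dx_fderiv hS hz, hY.dx_fderiv hS hz, sub_zero]
  have h3 : ∀ m μ, S.dv m μ z (VectorField.lieBracket ℝ X Y z)
      = along X (fun w => (Y w).2.2 m μ) z - along Y (fun w => (X w).2.2 m μ) z := fun m μ => by
    rw [VectorField.lieBracket, ← dvL_apply, map_sub, dvL_apply, dvL_apply,
      hX.dv_fderiv hS hz, hY.dv_fderiv hS hz]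
    rfl
  simp only [formX, h1, h2, h3, mul_zero, Finset.sum_const_zero, zero_add]

theorem curvT_eq (α η : Fin p) : S.curvT X Y z α η
    = along X (fun w => S.formT w (Y w) α η) z - along Y (fun w => S.formT w (X w) α η) z
      + ∑ m, (S.formT z (Y z) m η * S.formT z (X z) α m
        - S.formT z (X z) m η * S.formT z (Y z) α m) := by
  rw [curvT, blockCurv, hX.formT_lieBracket hY hS hz, sub_zero]

theorem curvX_eq (G : Fin n → Fin n → Fin p → Jet p n → ℝ)
    (L : Fin n → Fin n → Fin n → Jet p n → ℝ) (C : Fin n → Fin p → Fin n → Fin n → Jet p n → ℝ)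
    (l i : Fin n) : S.curvX G L C X Y z l i
    = along X (fun w => S.formX G L C w (Y w) l i) z - along Y (fun w => S.formX G L C w (X w) l i) z
      + ∑ m, (S.formX G L C z (Y z) m i * S.formX G L C z (X z) l m
        - S.formX G L C z (X z) m i * S.formX G L C z (Y z) l m)
      - ∑ m, ∑ μ, C l μ i m z * (along X (fun w => (Y w).2.2 m μ) z
        - along Y (fun w => (X w).2.2 m μ) z) := by
  rw [curvX, blockCurv, hX.formX_lieBracket hY hS hz]

end ConstBase

theorem Regular.along_comp_fst (hS : S.Regular) {f : (Fin p → ℝ) → ℝ} (hf : ContDiffOn ℝ ∞ f S.U)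
    (X : Jet p n → Jet p n) {z : Jet p n} (hz : z ∈ S.dom) :
    along X (fun w => f w.1) z = fderiv ℝ f z.1 (X z).1 := by
  have hd : DifferentiableAt ℝ f z.1 :=
    (hf.contDiffAt (hS.isOpen_U.mem_nhds hz.1)).differentiableAt (by simp)
  rw [along, show (fun w : Jet p n => f w.1) = f ∘ Prod.fst from rfl,
    (hd.hasFDerivAt.comp z hasFDerivAt_fst).fderiv]
  rfl

theorem δX_fst (i : Fin n) (z : Jet p n) : (S.δX i z).1 = 0 := funext fun β => S.dt_δX β i z

theorem δV_fst (i : Fin n) (α : Fin p) (z : Jet p n) : (S.δV i α z).1 = 0 := rfl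

theorem δT_fst (α : Fin p) (z : Jet p n) : (S.δT α z).1 = Pi.single α 1 := by
  funext β
  rw [show (S.δT α z).1 β = _ from S.dt_δT β α z, kron, Pi.single_apply]

end LocalData

theorem curv_self (A : LinConn p n) (X Z : Jet p n → Jet p n) (z : Jet p n) :
    curv A X X Z z = 0 := by
  simp [curv, VectorField.lieBracket_self, cov]

namespace LocalData

variable {S : LocalData p n} (hS : S.Regular) {z : Jet p n} (hz : z ∈ S.dom)
include hS hz

/-! ### The curvature forms on pairs of frame fields -/

namespace Regular

theorem curvT_TT (γ β α η : Fin p) :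
    S.curvT (S.δT γ) (S.δT β) z α η = S.Hcurv α η β γ z.1 := by
  rw [(hS.constBase_δT γ).curvT_eq (hS.constBase_δT β) hS hz]
  simp only [formT_δT, hS.along_comp_fst (hS.contDiffOn_H _ _ _) _ hz, δT_fst]
  rfl

/-- The temporal form is pulled back from `T`: it vanishes on `δ/δx` and `∂/∂x^k_γ`, and its
coefficients have no derivative in those directions. The same reason covers the remaining pairs
below. -/
theorem curvT_XT (k : Fin n) (β α η : Fin p) : S.curvT (S.δX k) (S.δT β) z α η = 0 := by
  rw [(hS.constBase_δX k).curvT_eq (hS.constBase_δT β) hS hz]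
  simp [hS.along_comp_fst (hS.contDiffOn_H _ _ _) _ hz, δX_fst]

theorem curvT_XX (k j : Fin n) (α η : Fin p) : S.curvT (S.δX k) (S.δX j) z α η = 0 := by
  rw [(hS.constBase_δX k).curvT_eq (hS.constBase_δX j) hS hz]
  simp

theorem curvT_VT (k : Fin n) (γ β α η : Fin p) : S.curvT (S.δV k γ) (S.δT β) z α η = 0 := by
  rw [(constBase_δV k γ).curvT_eq (hS.constBase_δT β) hS hz]
  simp [hS.along_comp_fst (hS.contDiffOn_H _ _ _) _ hz, δV_fst]

theorem curvT_VX (k : Fin n) (γ : Fin p) (j : Fin n) (α η : Fin p) :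
    S.curvT (S.δV k γ) (S.δX j) z α η = 0 := by
  rw [(constBase_δV k γ).curvT_eq (hS.constBase_δX j) hS hz]
  simp

theorem curvT_VV (k : Fin n) (γ : Fin p) (j : Fin n) (β α η : Fin p) :
    S.curvT (S.δV k γ) (S.δV j β) z α η = 0 := by
  rw [(constBase_δV k γ).curvT_eq (constBase_δV j β) hS hz]
  simp

variable (G : Fin n → Fin n → Fin p → Jet p n → ℝ) (L : Fin n → Fin n → Fin n → Jet p n → ℝ)
  (C : Fin n → Fin p → Fin n → Fin n → Jet p n → ℝ)

/-- The bracket term enters with a plus sign because the vertical components of the horizontal frame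
fields are `-M` and `-N`; likewise for the other pairs with a horizontal field. -/
theorem curvX_TT (γ β : Fin p) (l i : Fin n) : S.curvX G L C (S.δT γ) (S.δT β) z l i
    = along (S.δT γ) (G l i β) z - along (S.δT β) (G l i γ) z
      + ∑ m, (G m i β z * G l m γ z - G m i γ z * G l m β z)
      + ∑ m, ∑ μ, C l μ i m z * (along (S.δT γ) (S.M m μ β) z - along (S.δT β) (S.M m μ γ) z) := by
  rw [(hS.constBase_δT γ).curvX_eq (hS.constBase_δT β) hS hz, sub_eq_add_neg]
  simp only [formX_δT, δT_vert, along_neg, ← Finset.sum_neg_distrib]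
  congr 1
  exact Finset.sum_congr rfl fun m _ => Finset.sum_congr rfl fun μ _ => by ring

theorem curvX_XT (k : Fin n) (β : Fin p) (l i : Fin n) : S.curvX G L C (S.δX k) (S.δT β) z l i
    = along (S.δX k) (G l i β) z - along (S.δT β) (L l i k) z
      + ∑ m, (G m i β z * L l m k z - L m i k z * G l m β z)
      + ∑ m, ∑ μ, C l μ i m z * S.torTX m μ β k z := by
  rw [(hS.constBase_δX k).curvX_eq (hS.constBase_δT β) hS hz, sub_eq_add_neg]
  simp only [formX_δT, formX_δX, δT_vert, δX_vert, along_neg, ← Finset.sum_neg_distrib, torTX]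
  congr 1
  exact Finset.sum_congr rfl fun m _ => Finset.sum_congr rfl fun μ _ => by ring

theorem curvX_XX (k j l i : Fin n) : S.curvX G L C (S.δX k) (S.δX j) z l i
    = along (S.δX k) (L l i j) z - along (S.δX j) (L l i k) z
      + ∑ m, (L m i j z * L l m k z - L m i k z * L l m j z)
      + ∑ m, ∑ μ, C l μ i m z * S.torXX m μ j k z := by
  rw [(hS.constBase_δX k).curvX_eq (hS.constBase_δX j) hS hz, sub_eq_add_neg]
  simp only [formX_δX, δX_vert, along_neg, ← Finset.sum_neg_distrib, torXX]
  congr 1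
  exact Finset.sum_congr rfl fun m _ => Finset.sum_congr rfl fun μ _ => by ring

theorem curvX_VT (k : Fin n) (γ β : Fin p) (l i : Fin n) :
    S.curvX G L C (S.δV k γ) (S.δT β) z l i
    = pdV k γ (G l i β) z - along (S.δT β) (C l γ i k) z
      + ∑ m, (G m i β z * C l γ m k z - C m γ i k z * G l m β z)
      + ∑ m, ∑ μ, C l μ i m z * pdV k γ (S.M m μ β) z := by
  rw [(constBase_δV k γ).curvX_eq (hS.constBase_δT β) hS hz, sub_eq_add_neg]
  simp only [formX_δT, formX_δV, δT_vert, along_neg, ← Finset.sum_neg_distrib]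
  congr 1
  refine Finset.sum_congr rfl fun m _ => Finset.sum_congr rfl fun μ _ => ?_
  -- The field `∂/∂x^k_γ` has constant components, so one half of the bracket vanishes and only a
  -- vertical derivative of `M` remains.
  simp only [δV, along_const, pdV]
  simp only [show S.δV k γ = fun _ => eV k γ from rfl]
  ring

theorem curvX_VX (k : Fin n) (γ : Fin p) (j l i : Fin n) :
    S.curvX G L C (S.δV k γ) (S.δX j) z l i
    = pdV k γ (L l i j) z - along (S.δX j) (C l γ i k) z
      + ∑ m, (L m i j z * C l γ m k z - C m γ i k z * L l m j z)
      + ∑ m, ∑ μ, C l μ i m z * pdV k γ (S.N m μ j) z := by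
  rw [(constBase_δV k γ).curvX_eq (hS.constBase_δX j) hS hz, sub_eq_add_neg]
  simp only [formX_δX, formX_δV, δX_vert, along_neg, ← Finset.sum_neg_distrib]
  congr 1
  refine Finset.sum_congr rfl fun m _ => Finset.sum_congr rfl fun μ _ => ?_
  simp only [δV, along_const, pdV]
  simp only [show S.δV k γ = fun _ => eV k γ from rfl]
  ring

theorem curvX_VV (k : Fin n) (γ : Fin p) (j : Fin n) (β : Fin p) (l i : Fin n) :
    S.curvX G L C (S.δV k γ) (S.δV j β) z l i
    = pdV k γ (C l β i j) z - pdV j β (C l γ i k) z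
      + ∑ m, (C m β i j z * C l γ m k z - C m γ i k z * C l β m j z) := by
  rw [(constBase_δV k γ).curvX_eq (constBase_δV j β) hS hz]
  simp only [formX_δV]
  simp only [δV, along_const]
  simp
  rfl

end Regular

/-! ### The case `p = 1` -/

section One

variable {A : LinConn p n}

omit hz in
theorem IsCartan.contDiffOn_cG (hA : S.IsCartan A) (l i : Fin n) (γ : Fin p) :
    ContDiffOn ℝ ∞ (S.cG A l i γ) S.dom :=
  (hS.contDiffOn_canG l i γ).congr fun z hz => hA.G_eq l i γ z hz

omit hz in
theorem IsCartan.contDiffOn_cL (hA : S.IsCartan A) (l i j : Fin n) :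
    ContDiffOn ℝ ∞ (S.cL A l i j) S.dom :=
  (hS.contDiffOn_canL l i j).congr fun _ hz => hA.cL_eq hS hz l i j

omit hz in
theorem IsCartan.contDiffOn_cC (hA : S.IsCartan A) (l : Fin n) (γ : Fin p) (i j : Fin n) :
    ContDiffOn ℝ ∞ (S.cC A l γ i j) S.dom :=
  (hS.contDiffOn_canC l γ i j).congr fun _ hz => hA.cC_eq hS hz l γ i j

omit hS in
theorem Adapted.cGv_eq {G : Fin n → Fin n → Fin p → Jet p n → ℝ}
    {L : Fin n → Fin n → Fin n → Jet p n → ℝ} {C : Fin n → Fin p → Fin n → Fin n → Jet p n → ℝ}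
    (h : S.Adapted A G L C) (k : Fin n) (β α : Fin p) (i : Fin n) (γ : Fin p) :
    S.cGv A k β α i γ z = kron β α * G k i γ z - kron k i * S.H β α γ z.1 := by
  have := h.cov_δV (S.δT γ) z hz i β
  rw [cGv, this, ← dvL_apply]
  simp only [map_sum, map_smul]
  simp [dvL_apply, mul_left_comm _ (kron _ _) (kron _ _)]
  simp only [← Finset.mul_sum, sum_mul_kron, sum_kron_mul]

omit hS in
theorem Adapted.cLv_eq {G : Fin n → Fin n → Fin p → Jet p n → ℝ}
    {L : Fin n → Fin n → Fin n → Jet p n → ℝ} {C : Fin n → Fin p → Fin n → Fin n → Jet p n → ℝ}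
    (h : S.Adapted A G L C) (k : Fin n) (β α : Fin p) (i j : Fin n) :
    S.cLv A k β α i j z = kron β α * L k i j z := by
  have := h.cov_δV (S.δX j) z hz i β
  rw [cLv, this, ← dvL_apply]
  simp only [map_sum, map_smul]
  simp [dvL_apply, mul_left_comm _ (kron _ _) (kron _ _)]
  simp only [← Finset.mul_sum, sum_mul_kron, sum_kron_mul]

theorem IsCartan.curvatureTableOne [Subsingleton (Fin p)] (hA : S.IsCartan A) (τ : Fin p) :
    S.CurvatureTableOne A τ z := by
  have had := hA.toIsHNormal.adapted hS
  have hG := hA.contDiffOn_cG hS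
  have hL := hA.contDiffOn_cL hS
  have hC := hA.contDiffOn_cC hS
  have sT := hS.smooth_δT τ
  have sX := hS.smooth_δX
  have sV := fun k => Regular.smooth_δV (S := S) k τ
  have hone : ∀ f : Fin p → ℝ, ∑ μ, f μ = f τ := fun f => Fintype.sum_subsingleton f τ
  have hone' : ∀ f : Fin p → Jet p n, ∑ μ, f μ = f τ := fun f => Fintype.sum_subsingleton f τ
  have eXT : ∀ k l i, S.curvX (S.cG A) (S.cL A) (S.cC A) (S.δX k) (S.δT τ) z l i
      = S.oneRTX A τ l i k z := fun k l i => by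
    rw [hS.curvX_XT hz, oneRTX]
    simp only [hone, Finset.sum_sub_distrib]
    ring
  have eXX : ∀ k j l i, S.curvX (S.cG A) (S.cL A) (S.cC A) (S.δX k) (S.δX j) z l i
      = S.oneRXX A τ l i j k z := fun k j l i => by
    rw [hS.curvX_XX hz, oneRXX]
    simp only [hone, Finset.sum_sub_distrib]
    ring
  -- The `G` and `H` terms from the vertical index of `C` in the covariant derivative cancel those
  -- subtracted and added in `torPT`, leaving `C` times the vertical derivative of `M`. In `eVX` the
  -- `L` terms cancel against `torPX` in the same way.
  have eVT : ∀ k l i, S.curvX (S.cG A) (S.cL A) (S.cC A) (S.δV k τ) (S.δT τ) z l i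
      = S.onePT A τ l i k z := fun k l i => by
    rw [hS.curvX_VT hz, onePT, covTC]
    simp only [hone, Finset.sum_sub_distrib, torPT, had.cGv_eq hz, kron_self, one_mul, mul_sub,
      mul_add, Finset.sum_add_distrib, mul_comm (S.cC A l τ _ k z)]
    ring
  have eVX : ∀ k j l i, S.curvX (S.cG A) (S.cL A) (S.cC A) (S.δV k τ) (S.δX j) z l i
      = S.onePX A τ l i j k z := fun k j l i => by
    rw [hS.curvX_VX hz, onePX, covXC]
    simp only [hone, Finset.sum_sub_distrib, torPX, had.cLv_eq hz, kron_self, one_mul, mul_sub,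
      mul_comm (S.cC A l τ _ k z)]
    ring
  have eVV : ∀ k j l i, S.curvX (S.cG A) (S.cL A) (S.cC A) (S.δV k τ) (S.δV j τ) z l i
      = S.oneS A τ l i j k z := fun k j l i => by
    rw [hS.curvX_VV hz, oneS]
    simp only [Finset.sum_sub_distrib]
    ring
  constructor
  · exact curv_self _ _ _ _
  · exact fun i => curv_self _ _ _ _
  · exact fun i => curv_self _ _ _ _
  · intro k
    simp [had.curv_δT hS (sX k) sT hz, hS.curvT_XT hz]
  · intro k i
    simp only [had.curv_δX hS hG hL hC (sX k) sT hz, eXT]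
  · intro k i
    simp [had.curv_δV hS hG hL hC (sX k) sT hz, eXT, hone', hS.curvT_XT hz]
  · intro k j
    simp [had.curv_δT hS (sX k) (sX j) hz, hS.curvT_XX hz]
  · intro k j i
    simp only [had.curv_δX hS hG hL hC (sX k) (sX j) hz, eXX]
  · intro k j i
    simp [had.curv_δV hS hG hL hC (sX k) (sX j) hz, eXX, hone', hS.curvT_XX hz]
  · intro k
    simp [had.curv_δT hS (sV k) sT hz, hS.curvT_VT hz]
  · intro k i
    simp only [had.curv_δX hS hG hL hC (sV k) sT hz, eVT]
  · intro k i
    simp [had.curv_δV hS hG hL hC (sV k) sT hz, eVT, hone', hS.curvT_VT hz]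
  · intro k j
    simp [had.curv_δT hS (sV k) (sX j) hz, hS.curvT_VX hz]
  · intro k j i
    simp only [had.curv_δX hS hG hL hC (sV k) (sX j) hz, eVX]
  · intro k j i
    simp [had.curv_δV hS hG hL hC (sV k) (sX j) hz, eVX, hone', hS.curvT_VX hz]
  · intro k j
    simp [had.curv_δT hS (sV k) (sV j) hz, hS.curvT_VV hz]
  · intro k j i
    simp only [had.curv_δX hS hG hL hC (sV k) (sV j) hz, eVV]
  · intro k j i
    simp [had.curv_δV hS hG hL hC (sV k) (sV j) hz, eVV, hone', hS.curvT_VV hz]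

end One

end LocalData

/-! ### Independence of the fibre coordinates for `p ≥ 2` -/

/-- The vertical vector with components `u`. -/
def vert (u : Fin n → Fin p → ℝ) : Jet p n := (0, 0, u)

theorem vert_eq_sum (u : Fin n → Fin p → ℝ) :
    (vert u : Jet p n) = ∑ k, ∑ γ, u k γ • eV k γ := by
  refine Prod.ext ?_ (Prod.ext ?_ ?_)
  · simp [vert, eV, Prod.fst_sum]
  · simp [vert, eV, Prod.fst_sum, Prod.snd_sum]
  · ext i α
    simp [vert, Prod.snd_sum, LocalData.eV_apply]
    simp only [mul_left_comm (u _ _), ← Finset.mul_sum, sum_mul_kron, sum_kron_mul]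

namespace LocalData

variable {S : LocalData p n}

/-- The function `f` does not depend on the coordinates `x^i_α`. -/
def VertConst (S : LocalData p n) (f : Jet p n → ℝ) : Prop :=
  ∀ z ∈ S.dom, ∀ u, f (z + vert u) = f z

theorem add_vert_mem {z : Jet p n} (hz : z ∈ S.dom) (u : Fin n → Fin p → ℝ) :
    z + vert u ∈ S.dom := by
  simpa [dom, vert] using hz

section

variable (hS : S.Regular)
include hS

/-- The fibres of the domain are whole vector spaces, so the line from `z` in the direction `u`
never leaves the domain, and the function has zero derivative along it. -/
theorem vertConst_of_pdV_eq_zero {f : Jet p n → ℝ} (hf : ContDiffOn ℝ ∞ f S.dom)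
    (h : ∀ k γ, ∀ z ∈ S.dom, pdV k γ f z = 0) : S.VertConst f := by
  intro z hz u
  have hmem : ∀ s : ℝ, z + s • vert u ∈ S.dom := fun s => by
    simpa [vert] using add_vert_mem hz (s • u)
  have hd : ∀ s : ℝ, HasDerivAt (fun s : ℝ => f (z + s • vert u)) 0 s := fun s => by
    have h1 : HasDerivAt (fun s : ℝ => z + s • (vert u : Jet p n)) (vert u) s := by
      simpa using ((hasDerivAt_id s).smul_const (vert u : Jet p n)).const_add z
    have h2 := (hS.differentiableAt hf (hmem s)).hasFDerivAt.comp_hasDerivAt s h1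
    have h3 : fderiv ℝ f (z + s • vert u) (vert u) = 0 := by
      rw [vert_eq_sum u]
      simp only [map_sum, map_smul]
      refine Finset.sum_eq_zero fun k _ => Finset.sum_eq_zero fun γ _ => ?_
      rw [← vert_eq_sum u, show fderiv ℝ f (z + s • vert u) (eV k γ) = 0 from h k γ _ (hmem s),
        smul_zero]
    rwa [h3] at h2
  have := is_const_of_deriv_eq_zero (fun s => (hd s).differentiableAt) (fun s => (hd s).deriv) 1 0
  simpa using this

namespace VertConst

variable {f : Jet p n → ℝ} (h : S.VertConst f)
include h

theorem fderiv_add_vert {z : Jet p n} (hz : z ∈ S.dom) (u : Fin n → Fin p → ℝ) :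
    fderiv ℝ f (z + vert u) = fderiv ℝ f z := by
  rw [← fderiv_comp_add_right]
  exact Filter.EventuallyEq.fderiv_eq
    (Filter.eventually_of_mem (hS.dom_mem_nhds hz) fun w hw => h w hw u)

theorem pdX (i : Fin n) : S.VertConst (pdX i f) := fun z hz u => by
  rw [MultiTime.pdX, along, along, h.fderiv_add_vert hS hz]

theorem pdT (α : Fin p) : S.VertConst (pdT α f) := fun z hz u => by
  rw [MultiTime.pdT, along, along, h.fderiv_add_vert hS hz]

theorem pdV_eq_zero (hf : ContDiffOn ℝ ∞ f S.dom) {z : Jet p n} (hz : z ∈ S.dom) (k : Fin n)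
    (γ : Fin p) : pdV k γ f z = 0 := by
  have e : (eV k γ : Jet p n) = vert (Pi.single k (Pi.single γ 1)) := rfl
  have h1 : HasDerivAt (fun s : ℝ => z + s • (eV k γ : Jet p n)) (eV k γ) 0 := by
    simpa using ((hasDerivAt_id (0 : ℝ)).smul_const (eV k γ : Jet p n)).const_add z
  have h2 := (show HasFDerivAt f (fderiv ℝ f z) (z + (0 : ℝ) • (eV k γ : Jet p n)) by
    simpa using (hS.differentiableAt hf hz).hasFDerivAt).comp_hasDerivAt (0 : ℝ) h1
  have h3 : (f ∘ fun s : ℝ => z + s • (eV k γ : Jet p n)) = fun _ => f z := by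
    funext s
    have := h z hz (s • Pi.single k (Pi.single γ 1))
    simpa [e, vert] using this
  rw [h3] at h2
  exact h2.unique (hasDerivAt_const _ _)

/-- The adapted field differs from the coordinate field by vertical vectors, which annihilate a
fibrewise constant function. -/
theorem along_δX (hf : ContDiffOn ℝ ∞ f S.dom) {z : Jet p n} (hz : z ∈ S.dom) (k : Fin n) :
    along (S.δX k) f z = MultiTime.pdX k f z := by
  have := h.pdV_eq_zero hS hf hz
  simp only [pdV, along] at this
  simp [along, δX, MultiTime.pdX, this]

theorem along_δT (hf : ContDiffOn ℝ ∞ f S.dom) {z : Jet p n} (hz : z ∈ S.dom) (α : Fin p) :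
    along (S.δT α) f z = MultiTime.pdT α f z := by
  have := h.pdV_eq_zero hS hf hz
  simp only [pdV, along] at this
  simp [along, δT, MultiTime.pdT, this]

end VertConst

namespace Regular

theorem pdV_comm {f : Jet p n → ℝ} (hf : ContDiffOn ℝ ∞ f S.dom) {z : Jet p n} (hz : z ∈ S.dom)
    (i k : Fin n) (α γ : Fin p) : pdV k γ (pdV i α f) z = pdV i α (pdV k γ f) z := by
  have hd := hS.differentiableAt (hS.contDiffOn_fderiv hf) hz
  have key : ∀ a b : Jet p n, fderiv ℝ (fun w => fderiv ℝ f w a) z b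
      = fderiv ℝ (fderiv ℝ f) z b a := fun a b => by
    rw [fderiv_clm_apply hd (differentiableAt_const a)]
    simp
  have hsymm : IsSymmSndFDerivAt ℝ f z :=
    (hf.contDiffAt (hS.dom_mem_nhds hz)).isSymmSndFDerivAt
      (by simpa using WithTop.coe_le_coe.2 (le_top : (2 : ℕ∞) ≤ ⊤))
  change fderiv ℝ (fun w => fderiv ℝ f w (eV i α)) z (eV k γ)
    = fderiv ℝ (fun w => fderiv ℝ f w (eV k γ)) z (eV i α)
  rw [key, key, hsymm.eq]

/-- Both sides are half of a third vertical derivative of `L`, obtained by differentiating the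
Hessian condition; `h^{αβ}` depends on `t` only and passes through. The order of the derivatives in
`(i, α)` and `(k, γ)` is immaterial. -/
theorem hInv_mul_pdV_g {z : Jet p n} (hz : z ∈ S.dom) (i j k : Fin n) (α β γ : Fin p) :
    S.hInv α β z.1 * pdV k γ (S.g i j) z = S.hInv γ β z.1 * pdV i α (S.g k j) z := by
  have key : ∀ (i k : Fin n) (α γ : Fin p), pdV k γ (pdV i α (pdV j β S.L)) z
      = 2 * (S.hInv α β z.1 * pdV k γ (S.g i j) z) := by
    intro i k α γ
    have e : pdV i α (pdV j β S.L) =ᶠ[nhds z] fun w => 2 * (S.hInv α β w.1 * S.g i j w) :=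
      Filter.eventually_of_mem (hS.dom_mem_nhds hz) fun w hw => by
        have := hS.hessian w hw i j α β
        linarith
    rw [pdV, along_congr e]
    have h1 := hS.differentiableAt (contDiffOn_comp_fst (n := n) (hS.contDiffOn_hInv α β)) hz
    have h2 := hS.differentiableAt (hS.g_smooth i j) hz
    have h3 : fderiv ℝ (fun w : Jet p n => S.hInv α β w.1) z (eV k γ) = 0 := by
      have := hS.along_comp_fst (hS.contDiffOn_hInv α β) (fun _ => eV k γ) hz
      rw [along] at this
      rw [this]
      simp [eV]
    rw [along, fderiv_const_mul (h1.fun_mul h2), fderiv_fun_mul h1 h2]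
    simp [h3, pdV, along]
  have := hS.pdV_comm (hS.contDiffOn_pdV j β hS.L_smooth) hz i k α γ
  rw [key, key] at this
  linarith

/-- For `p ≥ 2` the metric `g` does not depend on the coordinates `x^i_α`. -/
theorem pdV_g_eq_zero (hp : 2 ≤ p) {z : Jet p n} (hz : z ∈ S.dom) (i j k : Fin n) (γ : Fin p) :
    pdV k γ (S.g i j) z = 0 := by
  -- Contraction with `h_{βα}` over both indices: the left side acquires the trace of the identity,
  -- which is `p`, and on the right the sum over `α` collapses to `γ`.
  have key : ∀ i k, (p : ℝ) * pdV k γ (S.g i j) z = pdV i γ (S.g k j) z := by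
    intro i k
    have h : ∀ α β, S.hInv α β z.1 * S.h β α z.1 * pdV k γ (S.g i j) z
        = S.hInv γ β z.1 * S.h β α z.1 * pdV i α (S.g k j) z := fun α β => by
      have := hS.hInv_mul_pdV_g hz i j k α β γ
      rw [mul_right_comm, this]
      ring
    have hi := fun α α' => matrix_inv_mul_apply (hS.h_det _ hz.1) α α'
    have h2 : ∑ α, ∑ β, S.hInv α β z.1 * S.h β α z.1 * pdV k γ (S.g i j) z
        = ∑ α, ∑ β, S.hInv γ β z.1 * S.h β α z.1 * pdV i α (S.g k j) z :=
      Finset.sum_congr rfl fun α _ => Finset.sum_congr rfl fun β _ => h α β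
    simp only [← Finset.sum_mul, hInv, hi, kron_self, sum_kron_mul] at h2
    simpa using h2
  have h1 := key i k
  have h2 := key k i
  have hp' : (2 : ℝ) ≤ p := by exact_mod_cast hp
  -- Exchanging `i` and `k` twice returns to the start with factor `p²`, which exceeds `1`.
  have h3 : ((p : ℝ) * p - 1) * pdV k γ (S.g i j) z = 0 := by
    rw [sub_mul, mul_assoc, h1, h2]
    ring
  rcases mul_eq_zero.1 h3 with h | h
  · nlinarith
  · exact h

variable (hp : 2 ≤ p)
include hp

theorem vertConst_g (i j : Fin n) : S.VertConst (S.g i j) :=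
  vertConst_of_pdV_eq_zero hS (hS.g_smooth i j) fun k γ _ hz => hS.pdV_g_eq_zero hp hz i j k γ

theorem vertConst_gInv (i j : Fin n) : S.VertConst (S.gInv i j) := fun z hz u => by
  simp only [gInv, fun a b => hS.vertConst_g hp a b z hz u]

theorem vertConst_Chr (l i j : Fin n) : S.VertConst (S.Chr l i j) := fun z hz u => by
  simp only [Chr, fun a b => hS.vertConst_gInv hp a b z hz u,
    fun k a b => (hS.vertConst_g hp a b).pdX hS k z hz u]

/-- Although `M` varies along the fibre, `δg/δt` equals `∂g/∂t`, which does not. -/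
theorem vertConst_canG (l i : Fin n) (γ : Fin p) : S.VertConst (S.canG l i γ) := fun z hz u => by
  simp only [canG, fun a b => hS.vertConst_gInv hp a b z hz u,
    fun a b => (hS.vertConst_g hp a b).along_δT hS (hS.g_smooth a b) hz,
    fun a b => (hS.vertConst_g hp a b).along_δT hS (hS.g_smooth a b) (add_vert_mem hz u),
    fun k a b => (hS.vertConst_g hp a b).pdT hS k z hz u]

theorem canL_eq_Chr {z : Jet p n} (hz : z ∈ S.dom) (l i j : Fin n) :
    S.canL l i j z = S.Chr l i j z := by
  simp only [canL, christoffel, Chr, gInv,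
    fun a b => (hS.vertConst_g hp a b).along_δX hS (hS.g_smooth a b) hz]

theorem canC_eq_zero {z : Jet p n} (hz : z ∈ S.dom) (l : Fin n) (γ : Fin p) (i j : Fin n) :
    S.canC l γ i j z = 0 := by
  have : ∀ a b k, along (S.δV k γ) (S.g a b) z = 0 :=
    fun a b k => hS.pdV_g_eq_zero hp hz a b k γ
  simp [canC, christoffel, this]

end Regular

/-! ### The case `p ≥ 2` -/

theorem IsCartan.curvatureTableMulti {A : LinConn p n} (hA : S.IsCartan A) (hp : 2 ≤ p)
    {z : Jet p n} (hz : z ∈ S.dom) : S.CurvatureTableMulti A z := by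
  -- Fibre independence of `g` replaces `L` by `Γ` and `C` by zero on the whole domain, so every
  -- bracket contribution disappears from the curvature forms.
  have had : S.Adapted A (S.cG A) S.Chr (fun _ _ _ _ _ => 0) :=
    (hA.adapted hS).congr (fun l i γ z hz => (hA.G_eq l i γ z hz).symm)
      (fun l i j _ hz => hS.canL_eq_Chr hp hz l i j)
      (fun l γ i j _ hz => hS.canC_eq_zero hp hz l γ i j)
  have hG := hA.contDiffOn_cG hS
  have hL := hS.contDiffOn_Chr
  have hC : ∀ (_ : Fin n) (_ : Fin p) (_ _ : Fin n),
      ContDiffOn ℝ ∞ (fun _ : Jet p n => (0 : ℝ)) S.dom := fun _ _ _ _ => contDiffOn_const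
  have sT := hS.smooth_δT
  have sX := hS.smooth_δX
  have sV := Regular.smooth_δV (S := S)
  -- The coefficients of `A` agree with the canonical ones only on the domain; that it is a
  -- neighbourhood of `z` suffices for the derivative.
  have vG : ∀ k γ l i β, pdV k γ (S.cG A l i β) z = 0 := fun k γ l i β => by
    rw [pdV, along_congr (Filter.eventually_of_mem (hS.dom_mem_nhds hz)
      fun w hw => hA.G_eq l i β w hw)]
    exact (hS.vertConst_canG hp l i β).pdV_eq_zero hS (hS.contDiffOn_canG l i β) hz k γ
  have vL : ∀ k γ l i j, pdV k γ (S.Chr l i j) z = 0 := fun k γ l i j =>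
    (hS.vertConst_Chr hp l i j).pdV_eq_zero hS (hL l i j) hz k γ
  have v0 : ∀ k γ, pdV k γ (fun _ : Jet p n => (0 : ℝ)) z = 0 := fun k γ => along_const _ _ _
  have eTT : ∀ γ β l i, S.curvX (S.cG A) S.Chr (fun _ _ _ _ _ => 0) (S.δT γ) (S.δT β) z l i
      = S.multiRTT A l i β γ z := fun γ β l i => by
    rw [hS.curvX_TT hz, multiRTT]
    simp [add_sub_assoc]
  have eXT : ∀ k β l i, S.curvX (S.cG A) S.Chr (fun _ _ _ _ _ => 0) (S.δX k) (S.δT β) z l i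
      = S.multiRTX A l i β k z := fun k β l i => by
    rw [hS.curvX_XT hz, multiRTX]
    simp [add_sub_assoc]
  have eXX : ∀ k j l i, S.curvX (S.cG A) S.Chr (fun _ _ _ _ _ => 0) (S.δX k) (S.δX j) z l i
      = S.r l i j k z := fun k j l i => by
    rw [hS.curvX_XX hz, r, (hS.vertConst_Chr hp l i j).along_δX hS (hL _ _ _) hz,
      (hS.vertConst_Chr hp l i k).along_δX hS (hL _ _ _) hz]
    simp
  have eVT : ∀ k γ β l i, S.curvX (S.cG A) S.Chr (fun _ _ _ _ _ => 0) (S.δV k γ) (S.δT β) z l i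
      = 0 := fun k γ β l i => by
    rw [hS.curvX_VT hz]
    simp [vG]
  have eVX : ∀ k γ j l i, S.curvX (S.cG A) S.Chr (fun _ _ _ _ _ => 0) (S.δV k γ) (S.δX j) z l i
      = 0 := fun k γ j l i => by
    rw [hS.curvX_VX hz]
    simp [vL]
  have eVV : ∀ k γ j β l i, S.curvX (S.cG A) S.Chr (fun _ _ _ _ _ => 0) (S.δV k γ) (S.δV j β) z l i
      = 0 := fun k γ j β l i => by
    rw [hS.curvX_VV hz]
    simp [v0]
  constructor
  · intro γ β η
    simp only [had.curv_δT hS (sT γ) (sT β) hz, hS.curvT_TT hz]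
  · intro γ β i
    simp only [had.curv_δX hS hG hL hC (sT γ) (sT β) hz, eTT]
  · intro γ β i α
    simp only [had.curv_δV hS hG hL hC (sT γ) (sT β) hz, eTT, hS.curvT_TT hz]
  · intro k β η
    simp [had.curv_δT hS (sX k) (sT β) hz, hS.curvT_XT hz]
  · intro k β i
    simp only [had.curv_δX hS hG hL hC (sX k) (sT β) hz, eXT]
  · intro k β i α
    simp [had.curv_δV hS hG hL hC (sX k) (sT β) hz, eXT, hS.curvT_XT hz]
  · intro k j η
    simp [had.curv_δT hS (sX k) (sX j) hz, hS.curvT_XX hz]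
  · intro k j i
    simp only [had.curv_δX hS hG hL hC (sX k) (sX j) hz, eXX]
  · intro k j i α
    simp [had.curv_δV hS hG hL hC (sX k) (sX j) hz, eXX, hS.curvT_XX hz]
  · intro k γ β η
    simp [had.curv_δT hS (sV k γ) (sT β) hz, hS.curvT_VT hz]
  · intro k γ β i
    simp [had.curv_δX hS hG hL hC (sV k γ) (sT β) hz, eVT]
  · intro k γ β i α
    simp [had.curv_δV hS hG hL hC (sV k γ) (sT β) hz, eVT, hS.curvT_VT hz]
  · intro k γ j η
    simp [had.curv_δT hS (sV k γ) (sX j) hz, hS.curvT_VX hz]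
  · intro k γ j i
    simp [had.curv_δX hS hG hL hC (sV k γ) (sX j) hz, eVX]
  · intro k γ j i α
    simp [had.curv_δV hS hG hL hC (sV k γ) (sX j) hz, eVX, hS.curvT_VX hz]
  · intro k γ j β η
    simp [had.curv_δT hS (sV k γ) (sV j β) hz, hS.curvT_VV hz]
  · intro k γ j β i
    simp [had.curv_δX hS hG hL hC (sV k γ) (sV j β) hz, eVV]
  · intro k γ j β i α
    simp [had.curv_δV hS hG hL hC (sV k γ) (sV j β) hz, eVV, hS.curvT_VV hz]

/-- Existence, uniqueness and curvature of the Cartan canonical connection in a chart. -/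
theorem Regular.exists_isCartan : ∃ A : LinConn p n, S.IsCartan A ∧
    (∀ A' : LinConn p n, S.IsCartan A' → Set.EqOn A' A S.dom) ∧
    (p = 1 → ∀ τ : Fin p, ∀ z ∈ S.dom, S.CurvatureTableOne A τ z) ∧
    (2 ≤ p → ∀ z ∈ S.dom, S.CurvatureTableMulti A z) := by
  have had : S.Adapted (S.adaptedConn S.canG S.canL S.canC) S.canG S.canL S.canC :=
    adapted_adaptedConn
  have hA := had.isCartan hS (hS.contDiffOn_adaptedConn hS.contDiffOn_canG hS.contDiffOn_canL
    hS.contDiffOn_canC)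
  refine ⟨_, hA, fun A' hA' => had.eqOn (hA'.adapted hS), ?_,
    fun hp z hz => hA.curvatureTableMulti hS hp hz⟩
  rintro rfl τ z hz
  exact hA.curvatureTableOne hS hz τ

end

end LocalData

/-! ### From the manifolds to a chart -/

theorem bijective_mfderiv_symm {m : ℕ} {X : Type*} [TopologicalSpace X]
    [ChartedSpace (Fin m → ℝ) X] [IsManifold 𝓘(ℝ, Fin m → ℝ) ∞ X]
    {φ : OpenPartialHomeomorph X (Fin m → ℝ)}
    (hφ : φ ∈ IsManifold.maximalAtlas 𝓘(ℝ, Fin m → ℝ) ∞ X) {t : Fin m → ℝ} (ht : t ∈ φ.target) :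
    Function.Bijective (mfderiv 𝓘(ℝ, Fin m → ℝ) 𝓘(ℝ, Fin m → ℝ) φ.symm t) := by
  have h : φ.MDifferentiable 𝓘(ℝ, Fin m → ℝ) 𝓘(ℝ, Fin m → ℝ) :=
    ⟨(contMDiffOn_of_mem_maximalAtlas hφ).mdifferentiableOn (by simp),
      (contMDiffOn_symm_of_mem_maximalAtlas hφ).mdifferentiableOn (by simp)⟩
  exact h.symm.mfderiv_bijective ht

/-- The Gram matrix of a nondegenerate symmetric bilinear form in a basis given by a linear
isomorphism is nonsingular. -/
theorem det_gram_ne_zero {m : ℕ} {V : Type*} [AddCommGroup V] [Module ℝ V]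
    (B : V →ₗ[ℝ] V →ₗ[ℝ] ℝ) (hs : ∀ u w, B u w = B w u) (hB : ∀ u, (∀ w, B u w = 0) → u = 0)
    (D : (Fin m → ℝ) →ₗ[ℝ] V) (hD : Function.Bijective D) :
    (Matrix.of fun a b : Fin m => B (D (Pi.single a 1)) (D (Pi.single b 1))).det ≠ 0 := by
  intro h0
  -- A null vector `v` of the Gram matrix yields `D v` orthogonal to the whole image of `D`, which
  -- is all of `V`; so `D v` lies in the radical and vanishes.
  obtain ⟨v, hv, hv0⟩ := Matrix.exists_mulVec_eq_zero_iff.2 h0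
  refine hv (hD.1 ?_)
  rw [map_zero]
  have hsum : ∀ x : Fin m → ℝ, D x = ∑ a, x a • D (Pi.single a 1) := fun x => by
    conv_lhs => rw [pi_eq_sum_univ' x]
    simp only [map_sum, map_smul]
  refine hB _ fun w => ?_
  obtain ⟨u, rfl⟩ := hD.2 w
  rw [hs, hsum u, map_sum]
  simp only [LinearMap.sum_apply, map_smul, LinearMap.smul_apply]
  refine Finset.sum_eq_zero fun a _ => ?_
  have := congrFun hv0 a
  simp only [Matrix.mulVec, dotProduct, Matrix.of_apply, Pi.zero_apply] at this
  rw [hsum v, map_sum]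
  simp only [map_smul, smul_eq_mul, mul_comm (v _), this, mul_zero]

theorem MetricalLagrangeSpace.regular_inChart
    {T : Type*} [TopologicalSpace T] [ChartedSpace (Fin p → ℝ) T]
    [IsManifold 𝓘(ℝ, Fin p → ℝ) ∞ T]
    {M : Type*} [TopologicalSpace M] [ChartedSpace (Fin n → ℝ) M]
    [IsManifold 𝓘(ℝ, Fin n → ℝ) ∞ M]
    (E : MetricalLagrangeSpace p n T M)
    {φ : OpenPartialHomeomorph T (Fin p → ℝ)}
    (hφ : φ ∈ IsManifold.maximalAtlas 𝓘(ℝ, Fin p → ℝ) ∞ T)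
    {ψ : OpenPartialHomeomorph M (Fin n → ℝ)}
    (hψ : ψ ∈ IsManifold.maximalAtlas 𝓘(ℝ, Fin n → ℝ) ∞ M) : (E.inChart φ ψ).Regular where
  isOpen_U := φ.open_target
  isOpen_V := ψ.open_target
  h_smooth := E.h_smooth φ hφ ψ hψ
  g_smooth := E.g_smooth φ hφ ψ hψ
  L_smooth := E.L_smooth φ hφ ψ hψ
  h_symm _ _ _ := E.h_symm _ _ _
  g_symm _ _ _ := E.g_symm _ _ _ _ _
  h_det t ht := det_gram_ne_zero
    (ContinuousLinearMap.toLinearMap₁₂ (E.h (φ.symm t))) (E.h_symm _) (E.h_nondeg _)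
    (mfderiv 𝓘(ℝ, Fin p → ℝ) 𝓘(ℝ, Fin p → ℝ) φ.symm t).toLinearMap (bijective_mfderiv_symm hφ ht)
  g_det z hz := det_gram_ne_zero
    (ContinuousLinearMap.toLinearMap₁₂ (E.g (φ.symm z.1) (ψ.symm z.2.1) (jetOf φ ψ z)))
    (E.g_symm _ _ _) (E.g_nondeg _ _ _)
    (mfderiv 𝓘(ℝ, Fin n → ℝ) 𝓘(ℝ, Fin n → ℝ) ψ.symm z.2.1).toLinearMap
    (bijective_mfderiv_symm hψ hz.2)
  hessian := E.regular φ hφ ψ hψ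

end MultiTime

theorem mainTheorem7 {p n : ℕ} (hp : 1 ≤ p)
    {T : Type*} [TopologicalSpace T] [ChartedSpace (Fin p → ℝ) T]
    [IsManifold 𝓘(ℝ, Fin p → ℝ) ∞ T]
    {M : Type*} [TopologicalSpace M] [ChartedSpace (Fin n → ℝ) M]
    [IsManifold 𝓘(ℝ, Fin n → ℝ) ∞ M]
    (E : MultiTime.MetricalLagrangeSpace p n T M)
    (φ : OpenPartialHomeomorph T (Fin p → ℝ))
    (hφ : φ ∈ IsManifold.maximalAtlas 𝓘(ℝ, Fin p → ℝ) ∞ T)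
    (ψ : OpenPartialHomeomorph M (Fin n → ℝ))
    (hψ : ψ ∈ IsManifold.maximalAtlas 𝓘(ℝ, Fin n → ℝ) ∞ M) :
    ∃ A : MultiTime.LinConn p n,
      (E.inChart φ ψ).IsCartan A ∧
      (∀ A' : MultiTime.LinConn p n, (E.inChart φ ψ).IsCartan A' →
        Set.EqOn A' A (E.inChart φ ψ).dom) ∧
      (p = 1 → ∀ τ : Fin p, ∀ z ∈ (E.inChart φ ψ).dom,
        (E.inChart φ ψ).CurvatureTableOne A τ z) ∧
      (2 ≤ p → ∀ z ∈ (E.inChart φ ψ).dom,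
        (E.inChart φ ψ).CurvatureTableMulti A z) :=
  (E.regular_inChart hφ hψ).exists_isCartan
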